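/- Let $(M,g,\tau)$ be a smooth four-dimensional oriented Lorentzian manifold of signature $(1,3)$ with volume form $\tau$ (i.e. $\tau=\pm1$ on orthonormal bases). Let $\delta=(-1)^p\star^{-1}d\,\star$ be the Hodge codifferential on $p$-forms, where $B\wedge\star A=(B\cdot A)\,\tau$. Let $R_\nu{}^\rho{}_{\sigma\mu}$ be the components of the Riemann tensor of the Levi-Civita connection $D$ of $g$ in a coordinate basis, with the convention $[D_{\partial_\sigma},D_{\partial_\mu}]\partial_\nu=R_\nu{}^\rho{}_{\sigma\mu}\,\partial_\rho$, let $R_{\nu\sigma}=R_\nu{}^\mu{}_{\sigma\mu}$ be the Ricci tensor (contraction over the last index; this is minus the Ricci tensor that is positive on round spheres), and let $\mathcal R_\beta=R_{\beta\nu}\,dx^\nu$ be the Ricci $1$-forms. Let $\mathbf K$ be a smooth Killing vector field, $\pounds_{\mathbf K}g=0$, and let $K=g(\mathbf K,\cdot)$, $M_K=dK$. Then, in every coordinate chart of $M$, $$J:=-\delta M_K=-\delta dK=2K^\beta\mathcal R_\beta .$$ Consequently, for every constant $\mathfrak e\in\mathbb R$, the potential $A=\mathfrak e K$ is in Lorenz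 gauge, $\delta A=0$, and its field $F=dA$ satisfies the Maxwell equations $dF=0$, $\delta F=-J_e$ with a current of superconducting type: in every coordinate chart, $J_e=-\delta dA=2A^\beta\mathcal R_\beta$, where $A^\beta=g^{\beta\alpha}A_\alpha$. -/

import Mathlib

open scoped Manifold ContDiff

noncomputable section

/-- The model space `ℝ⁴` of a four-dimensional manifold. -/
abbrev E4 : Type := EuclideanSpace ℝ (Fin 4)

/-- The `i`-th vector of the standard basis of `ℝ⁴`. -/
def stdVec (i : Fin 4) : E4 := EuclideanSpace.single i (1 : ℝ)

/-- The partial derivative `∂_i f` of a function on (an open part of) `ℝ⁴`. -/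
def pderiv4 (i : Fin 4) (f : E4 → ℝ) (y : E4) : ℝ := fderiv ℝ f y (stdVec i)

/-! ### Linear algebra: the Hodge star of a nondegenerate symmetric form on `ℝ⁴` -/

/-- The Gram matrix of a bilinear form in the standard basis. -/
def gramMatrix (g : E4 →L[ℝ] E4 →L[ℝ] ℝ) : Matrix (Fin 4) (Fin 4) ℝ :=
  Matrix.of fun i j => g (stdVec i) (stdVec j)

/-- The reciprocal basis `∂^i = ∑ j, g^{ij} ∂_j` of the standard basis, where `(g^{ij})` is the
inverse of the Gram matrix. -/
def recipVec (g : E4 →L[ℝ] E4 →L[ℝ] ℝ) (i : Fin 4) : E4 :=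
  ∑ j, (gramMatrix g)⁻¹ i j • stdVec j

/-- The contraction of a form with vectors in its first arguments: `α (u 0, …, u (k-1), ·)`. -/
def contractForm {m : ℕ} : ∀ {k : ℕ},
    (Fin k → E4) → E4 [⋀^Fin (m + k)]→L[ℝ] ℝ → E4 [⋀^Fin m]→L[ℝ] ℝ
  | 0, _, α => α
  | _ + 1, u, α => contractForm (Fin.tail u) (α.curryLeft (u 0))

/-- A `4`-form, regarded as an `n`-form where `n = 4`. -/
def castForm {n : ℕ} (h : n = 4) (τ : E4 [⋀^Fin 4]→L[ℝ] ℝ) : E4 [⋀^Fin n]→L[ℝ] ℝ := h ▸ τ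

/-- The Hodge star `⋆ : Λ^k → Λ^m`, `m + k = 4`, of the bilinear form `g` and the volume form `τ`:
`(⋆A)(v) = (1/k!) ∑ A(∂_{i₁}, …, ∂_{i_k}) τ(∂^{i₁}, …, ∂^{i_k}, v)`. For `g` nondegenerate and `τ` a
unit volume form it does not depend on the basis that is used, and it is the map such that
`B ∧ ⋆A = (B · A) τ` for all `k`-forms `B`. -/
def linHodgeStar (g : E4 →L[ℝ] E4 →L[ℝ] ℝ) (τ : E4 [⋀^Fin 4]→L[ℝ] ℝ) {k m : ℕ} (h : m + k = 4)
    (A : E4 [⋀^Fin k]→L[ℝ] ℝ) : E4 [⋀^Fin m]→L[ℝ] ℝ :=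
  ((k.factorial : ℝ)⁻¹) • ∑ i : Fin k → Fin 4,
    A (fun a => stdVec (i a)) •
      contractForm (fun a => recipVec g (i a)) (castForm h τ)

/-! ### Differential forms on a four-dimensional manifold -/

section Manifold

variable {M : Type*} [TopologicalSpace M] [ChartedSpace E4 M]

/-- A (not necessarily smooth) vector field. -/
abbrev VField (M : Type*) [TopologicalSpace M] [ChartedSpace E4 M] : Type _ :=
  Π x : M, TangentSpace 𝓘(ℝ, E4) x

/-- A (not necessarily smooth) differential `k`-form. -/
abbrev DForm (M : Type*) [TopologicalSpace M] [ChartedSpace E4 M] (k : ℕ) : Type _ :=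
  Π x : M, TangentSpace 𝓘(ℝ, E4) x [⋀^Fin k]→L[ℝ] ℝ

/-- The expression of a form in a chart `e`: its pullback under `e.symm`. -/
def formInChart (e : OpenPartialHomeomorph M E4) {k : ℕ} (α : DForm M k) :
    E4 → E4 [⋀^Fin k]→L[ℝ] ℝ := fun y =>
  (α (e.symm y)).compContinuousLinearMap (mfderiv 𝓘(ℝ, E4) 𝓘(ℝ, E4) e.symm y)

/-- The exterior derivative of a differential form, computed at `x` in the preferred chart
at `x`. -/
def extD {k : ℕ} (α : DForm M k) : DForm M (k + 1) := fun x =>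
  (extDeriv (formInChart (chartAt E4 x) α) (chartAt E4 x x)).compContinuousLinearMap
    (mfderiv 𝓘(ℝ, E4) 𝓘(ℝ, E4) (chartAt E4 x) x)

end Manifold

/-! ### Oriented Lorentzian spacetimes -/

/-- A four-dimensional oriented Lorentzian manifold: a smooth metric `g` of signature
`(1, 3)` with a smooth volume form `τ` that takes the values `±1` on orthonormal bases. -/
structure Spacetime (M : Type*) [TopologicalSpace M] [ChartedSpace E4 M]
    [IsManifold 𝓘(ℝ, E4) ∞ M] where
  /-- the metric of the tangent bundle -/
  g : Π x : M, TangentSpace 𝓘(ℝ, E4) x →L[ℝ] TangentSpace 𝓘(ℝ, E4) x →L[ℝ] ℝ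
  symm : ∀ (x : M) (v w : TangentSpace 𝓘(ℝ, E4) x), g x v w = g x w v
  signature : ∀ x : M, ∃ b : Module.Basis (Fin 4) ℝ (TangentSpace 𝓘(ℝ, E4) x),
    ∀ i j, g x (b i) (b j) = Matrix.diagonal ![(1 : ℝ), -1, -1, -1] i j
  contMDiff_g : ContMDiff 𝓘(ℝ, E4) (𝓘(ℝ, E4).prod 𝓘(ℝ, E4 →L[ℝ] E4 →L[ℝ] ℝ)) ∞
    (fun x => Bundle.TotalSpace.mk' (E4 →L[ℝ] E4 →L[ℝ] ℝ) x (g x))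
  /-- the volume form -/
  τ : DForm M 4
  vol : ∀ (x : M) (b : Module.Basis (Fin 4) ℝ (TangentSpace 𝓘(ℝ, E4) x)),
    (∀ i j, g x (b i) (b j) = Matrix.diagonal ![(1 : ℝ), -1, -1, -1] i j) →
      τ x b = 1 ∨ τ x b = -1
  contDiff_τ : ∀ x : M,
    ContDiffOn ℝ ∞ (formInChart (chartAt E4 x) τ) (chartAt E4 x).target

namespace Spacetime

variable {M : Type*} [TopologicalSpace M] [ChartedSpace E4 M] [IsManifold 𝓘(ℝ, E4) ∞ M]
  (S : Spacetime M)

/-- The Hodge star `⋆ : Λ^k → Λ^m`, `m + k = 4`. The tangent space at `x` is, by definition, the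
model space `ℝ⁴`, so that `linHodgeStar` applies to it. -/
def star {k m : ℕ} (h : m + k = 4) (A : DForm M k) : DForm M m := fun x =>
  linHodgeStar (S.g x) (S.τ x) h (A x)

/-- The inverse `⋆⁻¹ : Λ^k → Λ^m` of the Hodge star `⋆ : Λ^m → Λ^k`, `m + k = 4`; it is
`(-1)^{mk} sgn(det g) ⋆`, and `sgn(det g) = -1` in signature `(1, 3)`. -/
def starInv {k m : ℕ} (h : m + k = 4) (A : DForm M k) : DForm M m := fun x =>
  (-(-1 : ℝ) ^ (m * k)) • S.star h A x

/-- The Hodge codifferential `δ A = (-1)^p ⋆⁻¹ d ⋆ A` of a `p`-form, with `p = k + 1` and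
`m = 4 - p`. -/
def codiff {k m : ℕ} (h : m + (k + 1) = 4) (A : DForm M (k + 1)) : DForm M k := fun x =>
  ((-1 : ℝ) ^ (k + 1)) • S.starInv (k := m + 1) (by omega) (extD (S.star h A)) x

/-- The `1`-form `g(K, ·)` of a vector field `K`. -/
def flat (K : VField M) : DForm M 1 := fun x =>
  ContinuousAlternatingMap.ofSubsingleton ℝ _ ℝ (0 : Fin 1) (S.g x (K x))

/-- The codifferential of a `1`-form, a `0`-form. -/
def codiff₁ (A : DForm M 1) : DForm M 0 := S.codiff (k := 0) (m := 3) rfl A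

/-- The codifferential of a `2`-form, a `1`-form. -/
def codiff₂ (F : DForm M 2) : DForm M 1 := S.codiff (k := 1) (m := 2) rfl F

/-- The current `-δF` of a `2`-form `F`. -/
def current (F : DForm M 2) : DForm M 1 := fun x => -S.codiff₂ F x

/-- `K` is a Killing vector field: it is smooth and `£_K g = 0`, where
`(£_K g)(X, Y) = K(g(X, Y)) - g([K, X], Y) - g(X, [K, Y])`. -/
structure IsKilling (K : VField M) : Prop where
  contMDiff : ContMDiff 𝓘(ℝ, E4) 𝓘(ℝ, E4).tangent ∞
    (fun x => (⟨x, K x⟩ : TangentBundle 𝓘(ℝ, E4) M))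
  lie_eq_zero : ∀ (x : M) (X Y : VField M),
    MDifferentiableAt 𝓘(ℝ, E4) 𝓘(ℝ, E4).tangent
      (fun y => (⟨y, X y⟩ : TangentBundle 𝓘(ℝ, E4) M)) x →
    MDifferentiableAt 𝓘(ℝ, E4) 𝓘(ℝ, E4).tangent
      (fun y => (⟨y, Y y⟩ : TangentBundle 𝓘(ℝ, E4) M)) x →
    mvfderiv 𝓘(ℝ, E4) (fun y => S.g y (X y) (Y y)) x (K x)
      - S.g x (VectorField.mlieBracket 𝓘(ℝ, E4) K X x) (Y x)
      - S.g x (X x) (VectorField.mlieBracket 𝓘(ℝ, E4) K Y x) = 0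

/-! ### Components in a chart `e` of the atlas

The components are functions on the target of `e`. -/

section Chart

variable (e : OpenPartialHomeomorph M E4)

/-- The coordinate vector `∂_i` at the point with coordinates `y`. -/
def coordVec (i : Fin 4) (y : E4) : TangentSpace 𝓘(ℝ, E4) (e.symm y) :=
  mfderiv 𝓘(ℝ, E4) 𝓘(ℝ, E4) e.symm y (stdVec i)

/-- The coordinate covector `dx^i` at a point `x` of the domain of `e`, as a linear form. -/
def coordCovec (i : Fin 4) (x : M) : TangentSpace 𝓘(ℝ, E4) x →L[ℝ] ℝ :=
  (EuclideanSpace.proj i : E4 →L[ℝ] ℝ).comp (mfderiv 𝓘(ℝ, E4) 𝓘(ℝ, E4) e x)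

/-- The matrix `(g_{ij})` of the metric, `g_{ij} = g(∂_i, ∂_j)`. -/
def gLow (y : E4) : Matrix (Fin 4) (Fin 4) ℝ :=
  Matrix.of fun i j => S.g (e.symm y) (coordVec e i y) (coordVec e j y)

/-- The inverse matrix `(g^{ij})`. -/
def gUp (y : E4) : Matrix (Fin 4) (Fin 4) ℝ := (S.gLow e y)⁻¹

/-- The Christoffel symbols
`Γ^k_{ij} = (1/2) g^{kl} (∂_i g_{jl} + ∂_j g_{il} - ∂_l g_{ij})` of the Levi-Civita connection `D`,
so that `D_{∂_i} ∂_j = Γ^k_{ij} ∂_k`. -/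
def christoffel (k i j : Fin 4) (y : E4) : ℝ :=
  (1 / 2 : ℝ) * ∑ l, S.gUp e y k l *
    (pderiv4 i (fun z => S.gLow e z j l) y + pderiv4 j (fun z => S.gLow e z i l) y
      - pderiv4 l (fun z => S.gLow e z i j) y)

/-- The components `R_ν{}^ρ{}_{στ}` of the Riemann tensor of the Levi-Civita connection,
`([D_{∂_σ}, D_{∂_τ}]) ∂_ν = R_ν{}^ρ{}_{στ} ∂_ρ`. -/
def riemann (ν ρ σ τ : Fin 4) (y : E4) : ℝ :=
  pderiv4 σ (S.christoffel e ρ τ ν) y - pderiv4 τ (S.christoffel e ρ σ ν) y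
    + ∑ l, (S.christoffel e ρ σ l y * S.christoffel e l τ ν y
      - S.christoffel e ρ τ l y * S.christoffel e l σ ν y)

/-- The components `R_{νσ} = R_ν{}^μ{}_{σμ}` of the Ricci tensor. The contraction is over the last
index of the Riemann tensor, so this is minus the Ricci tensor that is positive on round
spheres. -/
def ricci (ν σ : Fin 4) (y : E4) : ℝ := ∑ μ, S.riemann e ν μ σ μ y

/-- The Ricci `1`-form `𝓡_β = R_{βν} dx^ν` on the domain of `e`. -/
def ricciForm (β : Fin 4) : DForm M 1 := fun x =>
  ContinuousAlternatingMap.ofSubsingleton ℝ _ ℝ (0 : Fin 1)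
    (∑ ν, S.ricci e β ν (e x) • coordCovec e ν x)

/-- The contravariant components `A^β = g^{βα} A(∂_α)` of a `1`-form at a point `x` of the
domain of `e`. -/
def upComp (A : DForm M 1) (β : Fin 4) (x : M) : ℝ :=
  ∑ α, S.gUp e (e x) β α * formInChart e A (e x) (fun _ => stdVec α)

end Chart

end Spacetime

end

/-! The statement is local, so it is proved in one chart at a time. There the metric components `G`,
the number `t = τ(∂₀, ∂₁, ∂₂, ∂₃)` and the components `k` of the field are functions on an open set
of ℝ⁴, and `KillingComponents` collects what is known of them. Since t² = -det G, `t` is ±√|det G|,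
and ∂_b t = t Γ^a_{ab} (`trace_chris`) whatever its sign.

The Killing equation reads D_i K_j + D_j K_i = 0. Hence dK = 2 DK (`curlComp_eq`) and D_b K^b = 0
(`trace_covComp`). Commuting the derivatives in D_b D_c K^b leaves D_c D_b K^b, which vanishes, and
a curvature term: D_b D_c K^b = -K^l R_{lc} in the Ricci convention used here (`div_covComp`). For F
= dK one has F^b{}_c = -2 D_c K^b, so D_b F^b{}_c = 2 K^l R_{lc}; `sum_pderiv_raiseTwo` is this
identity written as g_{cd} ∂_b(t F^{bd}) = 2 t K^l R_{lc}.

The link with forms is that ⋆ turns d into a divergence. The 4-form d⋆K has the single component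
∂_b(t K^b) = t D_b K^b = 0, which is the Lorenz gauge (`extDeriv_star_oneForm`), and ⋆d⋆F has the
components -t⁻¹ g_{cd} ∂_b(t F^{bd}) (`star_extDeriv_star_twoForm`).

Passing from the manifold to a chart needs three facts: ⋆ is natural under linear isomorphisms
(`linHodgeStar_compContinuousLinearMap`), d commutes with pullback along transition maps
(`formInChart_extD`), and £_K g = 0 tested on coordinate fields is the Killing equation in
components (`IsKilling.killingComponents`). A constant multiple of a Killing field is Killing, so
the potential 𝔢K needs no separate computation, apart from d² = 0. -/

noncomputable section

/-! ### Calculus of component functions -/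

section pderiv

variable {f h : E4 → ℝ} {y : E4}

theorem pderiv4_add (hf : DifferentiableAt ℝ f y) (hh : DifferentiableAt ℝ h y) (i : Fin 4) :
    pderiv4 i (fun z => f z + h z) y = pderiv4 i f y + pderiv4 i h y := by
  simp [pderiv4, fderiv_fun_add hf hh]

theorem pderiv4_mul (hf : DifferentiableAt ℝ f y) (hh : DifferentiableAt ℝ h y) (i : Fin 4) :
    pderiv4 i (fun z => f z * h z) y = f y * pderiv4 i h y + pderiv4 i f y * h y := by
  simp [pderiv4, fderiv_fun_mul hf hh, mul_comm]

theorem pderiv4_sum {ι : Type*} (s : Finset ι) {F : ι → E4 → ℝ}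
    (hF : ∀ a ∈ s, DifferentiableAt ℝ (F a) y) (i : Fin 4) :
    pderiv4 i (fun z => ∑ a ∈ s, F a z) y = ∑ a ∈ s, pderiv4 i (F a) y := by
  simp [pderiv4, fderiv_fun_sum hF]

theorem pderiv4_const_mul (c : ℝ) (hf : DifferentiableAt ℝ f y) (i : Fin 4) :
    pderiv4 i (fun z => c * f z) y = c * pderiv4 i f y := by
  simp [pderiv4, fderiv_const_mul hf]

theorem pderiv4_congr (hfh : f =ᶠ[nhds y] h) (i : Fin 4) : pderiv4 i f y = pderiv4 i h y := by
  simp [pderiv4, hfh.fderiv_eq]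

theorem ContDiffAt.pderiv4 (hf : ContDiffAt ℝ ∞ f y) (i : Fin 4) :
    ContDiffAt ℝ ∞ (_root_.pderiv4 i f) y :=
  (hf.fderiv_right (m := ∞) (by simp)).clm_apply contDiffAt_const

theorem two_le_smooth : (2 : WithTop ℕ∞) ≤ ∞ :=
  (WithTop.coe_le_coe.2 le_top : ((2 : ℕ∞) : WithTop ℕ∞) ≤ ((⊤ : ℕ∞) : WithTop ℕ∞))

theorem pderiv4_comm (hf : ContDiffAt ℝ ∞ f y) (i j : Fin 4) :
    pderiv4 i (pderiv4 j f) y = pderiv4 j (pderiv4 i f) y := by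
  have hd : DifferentiableAt ℝ (fderiv ℝ f) y :=
    (hf.fderiv_right (m := ∞) (by simp)).differentiableAt (by simp)
  have key : ∀ a b : Fin 4, pderiv4 a (pderiv4 b f) y =
      fderiv ℝ (fderiv ℝ f) y (stdVec a) (stdVec b) := fun a b => by
    change fderiv ℝ (fun z => fderiv ℝ f z (stdVec b)) y (stdVec a) = _
    rw [fderiv_clm_apply hd (by fun_prop)]
    simp
  rw [key, key]
  exact hf.isSymmSndFDerivAt (by simpa using two_le_smooth) (stdVec i) (stdVec j)

end pderiv

theorem ContDiffAt.differentiableAt_of_smooth {f : E4 → ℝ} {y : E4} (hf : ContDiffAt ℝ ∞ f y) :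
    DifferentiableAt ℝ f y := hf.differentiableAt (by simp)

/-- The determinant as a continuous multilinear map of the rows. -/
def detCMM : ContinuousMultilinearMap ℝ (fun _ : Fin 4 => Fin 4 → ℝ) ℝ where
  toMultilinearMap := (Matrix.detRowAlternating (n := Fin 4) (R := ℝ)).toMultilinearMap
  cont := by
    change Continuous fun M : Matrix (Fin 4) (Fin 4) ℝ => M.det
    fun_prop

theorem detCMM_apply (M : Fin 4 → Fin 4 → ℝ) : detCMM M = Matrix.det (Matrix.of M) := rfl

/-- Jacobi's formula. -/
theorem pderiv4_det {G : E4 → Matrix (Fin 4) (Fin 4) ℝ} {y : E4}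
    (hG : ∀ i j, DifferentiableAt ℝ (fun z => G z i j) y) (b : Fin 4) :
    pderiv4 b (fun z => (G z).det) y =
      ∑ i, ∑ j, pderiv4 b (fun z => G z i j) y * (G y).adjugate j i := by
  have hG' : HasFDerivAt (fun z (i j : Fin 4) => G z i j)
      (ContinuousLinearMap.pi fun i => ContinuousLinearMap.pi fun j =>
        fderiv ℝ (fun z => G z i j) y) y :=
    hasFDerivAt_pi.2 fun i => hasFDerivAt_pi.2 fun j => (hG i j).hasFDerivAt
  have h2 := (detCMM.hasFDerivAt (fun i j => G y i j)).comp y hG'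
  have h4 : pderiv4 b (fun z => (G z).det) y =
      detCMM.linearDeriv (fun i j => G y i j)
        (fun i j => pderiv4 b (fun z => G z i j) y) :=
    congrArg (fun l : E4 →L[ℝ] ℝ => l (stdVec b)) h2.fderiv
  rw [h4, ContinuousMultilinearMap.linearDeriv_apply]
  refine Finset.sum_congr rfl fun i _ => ?_
  rw [detCMM_apply]
  have h5 : Matrix.of (Function.update (fun i j => G y i j) i
      (fun j => pderiv4 b (fun z => G z i j) y)) =
      (G y).updateRow i (fun j => pderiv4 b (fun z => G z i j) y) := rfl
  -- By Cramer's rule, a determinant with one row replaced is the pairing of the new row with a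
  -- column of the adjugate.
  rw [h5, ← Matrix.cramer_transpose_apply, Matrix.cramer_eq_adjugate_mulVec,
    ← Matrix.adjugate_transpose, Matrix.mulVec, dotProduct]
  refine Finset.sum_congr rfl fun j _ => ?_
  rw [Matrix.transpose_apply, mul_comm]

/-! ### The Levi-Civita connection of a matrix of component functions -/

/-- Christoffel symbols of the metric components `G`. -/
def chris (G : E4 → Matrix (Fin 4) (Fin 4) ℝ) (k i j : Fin 4) (y : E4) : ℝ :=
  (1 / 2 : ℝ) * ∑ l, (G y)⁻¹ k l *
    (pderiv4 i (fun z => G z j l) y + pderiv4 j (fun z => G z i l) y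
      - pderiv4 l (fun z => G z i j) y)

/-- Ricci components of the metric components `G`, contracted over the last index of the Riemann
tensor. -/
def ricciComp (G : E4 → Matrix (Fin 4) (Fin 4) ℝ) (ν σ : Fin 4) (y : E4) : ℝ :=
  ∑ μ, (pderiv4 σ (chris G μ μ ν) y - pderiv4 μ (chris G μ σ ν) y
    + ∑ l, (chris G μ σ l y * chris G l μ ν y - chris G μ μ l y * chris G l σ ν y))

/-- Smooth symmetric metric components `G` on an open set `U`, a smooth function `t` with
`t² = -det G ≠ 0`, and smooth components `k` of a Killing vector field. -/
structure KillingComponents (U : Set E4) (G : E4 → Matrix (Fin 4) (Fin 4) ℝ) (t : E4 → ℝ)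
    (k : Fin 4 → E4 → ℝ) : Prop where
  isOpen : IsOpen U
  smooth_G : ∀ y ∈ U, ∀ i j, ContDiffAt ℝ ∞ (fun z => G z i j) y
  symm : ∀ y ∈ U, ∀ i j, G y i j = G y j i
  smooth_t : ∀ y ∈ U, ContDiffAt ℝ ∞ t y
  t_ne : ∀ y ∈ U, t y ≠ 0
  t_sq : ∀ y ∈ U, t y ^ 2 = -(G y).det
  smooth_k : ∀ y ∈ U, ∀ i, ContDiffAt ℝ ∞ (k i) y
  killing : ∀ y ∈ U, ∀ i j, ∑ l, (k l y * pderiv4 l (fun z => G z i j) y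
    + G y l j * pderiv4 i (k l) y + G y i l * pderiv4 j (k l) y) = 0

namespace KillingComponents

variable {U : Set E4} {G : E4 → Matrix (Fin 4) (Fin 4) ℝ} {t : E4 → ℝ} {k : Fin 4 → E4 → ℝ}
  (hK : KillingComponents U G t k) {y : E4}

include hK

theorem det_ne (hy : y ∈ U) : (G y).det ≠ 0 := fun h => by
  have := hK.t_sq y hy
  rw [h, neg_zero] at this
  exact hK.t_ne y hy (pow_eq_zero_iff (by norm_num) |>.1 this)

theorem mul_inv (hy : y ∈ U) (i j : Fin 4) :
    ∑ a, G y i a * (G y)⁻¹ a j = if i = j then 1 else 0 := by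
  have := congrFun (congrFun (Matrix.mul_nonsing_inv (G y) (hK.det_ne hy).isUnit) i) j
  simpa [Matrix.mul_apply, Matrix.one_apply] using this

theorem inv_mul (hy : y ∈ U) (i j : Fin 4) :
    ∑ a, (G y)⁻¹ i a * G y a j = if i = j then 1 else 0 := by
  have := congrFun (congrFun (Matrix.nonsing_inv_mul (G y) (hK.det_ne hy).isUnit) i) j
  simpa [Matrix.mul_apply, Matrix.one_apply] using this

theorem inv_symm (hy : y ∈ U) (i j : Fin 4) : (G y)⁻¹ i j = (G y)⁻¹ j i := by
  have h : (G y).transpose = G y := by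
    ext a b
    exact hK.symm y hy b a
  have := congrFun (congrFun (Matrix.transpose_nonsing_inv (G y)) j) i
  rw [h] at this
  exact this

theorem mem_nhds (hy : y ∈ U) : U ∈ nhds y := hK.isOpen.mem_nhds hy

theorem dG (hy : y ∈ U) (i j : Fin 4) : DifferentiableAt ℝ (fun z => G z i j) y :=
  (hK.smooth_G y hy i j).differentiableAt (by simp)

theorem dk (hy : y ∈ U) (i : Fin 4) : DifferentiableAt ℝ (k i) y :=
  (hK.smooth_k y hy i).differentiableAt (by simp)

theorem dt (hy : y ∈ U) : DifferentiableAt ℝ t y := (hK.smooth_t y hy).differentiableAt (by simp)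

theorem pderiv_G_symm (hy : y ∈ U) (l i j : Fin 4) :
    pderiv4 l (fun z => G z i j) y = pderiv4 l (fun z => G z j i) y :=
  pderiv4_congr (Filter.mem_of_superset (hK.mem_nhds hy) fun z hz => hK.symm z hz i j) l

theorem smooth_det (hy : y ∈ U) : ContDiffAt ℝ ∞ (fun z => (G z).det) y := by
  simp only [Matrix.det_apply]
  refine ContDiffAt.sum fun σ _ => ?_
  refine ContDiffAt.const_smul _ ?_
  exact contDiffAt_prod fun i _ => hK.smooth_G y hy _ _

theorem smooth_adjugate (hy : y ∈ U) (i j : Fin 4) :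
    ContDiffAt ℝ ∞ (fun z => (G z).adjugate i j) y := by
  simp only [Matrix.adjugate_apply, Matrix.det_apply]
  refine ContDiffAt.sum fun σ _ => ?_
  refine ContDiffAt.const_smul _ ?_
  refine contDiffAt_prod fun a _ => ?_
  by_cases h : σ a = j
  · simp only [h, Matrix.updateRow_self]
    exact contDiffAt_const
  · simp only [Matrix.updateRow_ne h]
    exact hK.smooth_G y hy _ _

theorem smooth_inv (hy : y ∈ U) (i j : Fin 4) : ContDiffAt ℝ ∞ (fun z => (G z)⁻¹ i j) y := by
  simp only [Matrix.inv_def, Ring.inverse_eq_inv', Matrix.smul_apply, smul_eq_mul]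
  exact ((hK.smooth_det hy).inv (hK.det_ne hy)).mul (hK.smooth_adjugate hy i j)

theorem smooth_chris (hy : y ∈ U) (a i j : Fin 4) : ContDiffAt ℝ ∞ (chris G a i j) y := by
  unfold chris
  refine contDiffAt_const.mul (ContDiffAt.sum fun l _ => (hK.smooth_inv hy a l).mul ?_)
  exact (((hK.smooth_G y hy j l).pderiv4 i).add ((hK.smooth_G y hy i l).pderiv4 j)).sub
    ((hK.smooth_G y hy i j).pderiv4 l)

theorem chris_symm (hy : y ∈ U) (a i j : Fin 4) : chris G a i j y = chris G a j i y := by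
  simp only [chris, hK.pderiv_G_symm hy _ i j]
  congr 1
  refine Finset.sum_congr rfl fun l _ => ?_
  ring

/-- Lowering the upper index cancels the inverse metric and leaves the Christoffel symbols of the
first kind, which are linear in ∂G. -/
theorem lower_chris (hy : y ∈ U) (d i j : Fin 4) :
    ∑ a, G y d a * chris G a i j y = (1 / 2 : ℝ) * (pderiv4 i (fun z => G z j d) y
      + pderiv4 j (fun z => G z i d) y - pderiv4 d (fun z => G z i j) y) := by
  simp only [chris]
  set X : Fin 4 → ℝ := fun l => pderiv4 i (fun z => G z j l) y + pderiv4 j (fun z => G z i l) y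
      - pderiv4 l (fun z => G z i j) y with hX
  calc ∑ a, G y d a * ((1 / 2 : ℝ) * ∑ l, (G y)⁻¹ a l * X l)
      = (1 / 2 : ℝ) * ∑ l, (∑ a, G y d a * (G y)⁻¹ a l) * X l := by
        simp only [Finset.mul_sum, Finset.sum_mul]
        rw [Finset.sum_comm]
        exact Finset.sum_congr rfl fun _ _ => Finset.sum_congr rfl fun _ _ => by ring
    _ = (1 / 2 : ℝ) * X d := by simp [hK.mul_inv hy]

/-- The trace of the Christoffel symbols is the logarithmic derivative of the volume density. -/
theorem trace_chris (hy : y ∈ U) (b : Fin 4) :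
    t y * ∑ a, chris G a a b y = pderiv4 b t y := by
  -- Differentiating t² = -det G avoids the square root, so neither orientation is preferred.
  have h1 : 2 * (t y * pderiv4 b t y) = -pderiv4 b (fun z => (G z).det) y := by
    have : pderiv4 b (fun z => t z * t z) y = pderiv4 b (fun z => (-1) * (G z).det) y :=
      pderiv4_congr (Filter.mem_of_superset (hK.mem_nhds hy) fun z hz => by
        have := hK.t_sq z hz
        change t z * t z = (-1) * (G z).det
        linear_combination this) b
    rw [pderiv4_mul (hK.dt hy) (hK.dt hy),
      pderiv4_const_mul _ (hK.smooth_det hy).differentiableAt_of_smooth] at this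
    linear_combination this
  have h2 : ∑ a, chris G a a b y =
      (1 / 2 : ℝ) * ∑ i, ∑ j, pderiv4 b (fun z => G z i j) y * (G y)⁻¹ j i := by
    simp only [chris, ← Finset.mul_sum]
    congr 1
    -- In the trace the first and third terms of the Christoffel symbol cancel, by the symmetry of G
    -- and its inverse.
    have h3 : ∑ a, ∑ l, (G y)⁻¹ a l * pderiv4 a (fun z => G z b l) y =
        ∑ a, ∑ l, (G y)⁻¹ a l * pderiv4 l (fun z => G z a b) y := by
      rw [Finset.sum_comm]
      refine Finset.sum_congr rfl fun a _ => Finset.sum_congr rfl fun l _ => ?_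
      rw [hK.inv_symm hy, hK.pderiv_G_symm hy]
    simp only [mul_add, mul_sub, Finset.sum_add_distrib, Finset.sum_sub_distrib, h3]
    rw [add_sub_cancel_left]
    refine Finset.sum_congr rfl fun a _ => Finset.sum_congr rfl fun l _ => ?_
    rw [hK.inv_symm hy a l, mul_comm]
  have h4 : ∑ i, ∑ j, pderiv4 b (fun z => G z i j) y * (G y)⁻¹ j i =
      ((G y).det)⁻¹ * pderiv4 b (fun z => (G z).det) y := by
    rw [pderiv4_det (hK.dG hy)]
    simp only [Finset.mul_sum, Matrix.inv_def, Ring.inverse_eq_inv', Matrix.smul_apply, smul_eq_mul]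
    exact Finset.sum_congr rfl fun _ _ => Finset.sum_congr rfl fun _ _ => by ring
  have h5 : pderiv4 b (fun z => (G z).det) y = -(2 * (t y * pderiv4 b t y)) := by
    linear_combination h1
  have h6 : (G y).det = -(t y ^ 2) := by
    linear_combination hK.t_sq y hy
  rw [h2, h4, h5, h6]
  have := hK.t_ne y hy
  field_simp

end KillingComponents

/-! ### The field dK of a Killing vector and its divergence -/

/-- The components `K_j = g_{jl} K^l`. -/
def lowComp (G : E4 → Matrix (Fin 4) (Fin 4) ℝ) (k : Fin 4 → E4 → ℝ) (j : Fin 4) (y : E4) : ℝ :=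
  ∑ l, G y j l * k l y

/-- The components `∂_i K_j - ∂_j K_i` of `dK`. -/
def curlComp (G : E4 → Matrix (Fin 4) (Fin 4) ℝ) (k : Fin 4 → E4 → ℝ) (i j : Fin 4) (y : E4) : ℝ :=
  pderiv4 i (lowComp G k j) y - pderiv4 j (lowComp G k i) y

/-- The components `F^{bd}` of the bivector that corresponds to the `2`-form `F_{ij}`. -/
def raiseTwo (G : E4 → Matrix (Fin 4) (Fin 4) ℝ) (F : Fin 4 → Fin 4 → E4 → ℝ) (b d : Fin 4)
    (y : E4) : ℝ :=
  ∑ i, ∑ j, (G y)⁻¹ b i * (G y)⁻¹ d j * F i j y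

/-- The components `D_e K^b` of the covariant derivative of `K`. -/
def covComp (G : E4 → Matrix (Fin 4) (Fin 4) ℝ) (k : Fin 4 → E4 → ℝ) (b e : Fin 4) (y : E4) : ℝ :=
  pderiv4 e (k b) y + ∑ l, chris G b e l y * k l y

theorem sum_symm_mul_antisymm {A B : Fin 4 → Fin 4 → ℝ} (hA : ∀ i j, A i j = A j i)
    (hB : ∀ i j, B i j = -B j i) : ∑ i, ∑ j, A i j * B i j = 0 := by
  have h : ∑ i, ∑ j, A i j * B i j = -∑ i, ∑ j, A i j * B i j := by
    conv_lhs => rw [Finset.sum_comm]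
    simp only [← Finset.sum_neg_distrib]
    refine Finset.sum_congr rfl fun i _ => Finset.sum_congr rfl fun j _ => ?_
    rw [hA j i, hB j i]
    ring
  linarith

namespace KillingComponents

variable {U : Set E4} {G : E4 → Matrix (Fin 4) (Fin 4) ℝ} {t : E4 → ℝ} {k : Fin 4 → E4 → ℝ}
  (hK : KillingComponents U G t k) {y : E4}

theorem curlComp_antisymm (i j : Fin 4) : curlComp G k i j y = -curlComp G k j i y := by
  simp [curlComp]

theorem raiseTwo_antisymm (b d : Fin 4) :
    raiseTwo G (curlComp G k) b d y = -raiseTwo G (curlComp G k) d b y := by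
  simp only [raiseTwo, ← Finset.sum_neg_distrib]
  rw [Finset.sum_comm]
  refine Finset.sum_congr rfl fun i _ => Finset.sum_congr rfl fun j _ => ?_
  rw [curlComp_antisymm]
  ring

include hK

theorem smooth_lowComp (hy : y ∈ U) (j : Fin 4) : ContDiffAt ℝ ∞ (lowComp G k j) y :=
  ContDiffAt.sum fun l _ => (hK.smooth_G y hy j l).mul (hK.smooth_k y hy l)

theorem smooth_curlComp (hy : y ∈ U) (i j : Fin 4) : ContDiffAt ℝ ∞ (curlComp G k i j) y :=
  ((hK.smooth_lowComp hy j).pderiv4 i).sub ((hK.smooth_lowComp hy i).pderiv4 j)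

theorem smooth_raiseTwo (hy : y ∈ U) (b d : Fin 4) :
    ContDiffAt ℝ ∞ (raiseTwo G (curlComp G k) b d) y :=
  ContDiffAt.sum fun i _ => ContDiffAt.sum fun j _ =>
    ((hK.smooth_inv hy b i).mul (hK.smooth_inv hy d j)).mul (hK.smooth_curlComp hy i j)

theorem smooth_covComp (hy : y ∈ U) (b e : Fin 4) : ContDiffAt ℝ ∞ (covComp G k b e) y :=
  ((hK.smooth_k y hy b).pderiv4 e).add
    (ContDiffAt.sum fun l _ => (hK.smooth_chris hy b e l).mul (hK.smooth_k y hy l))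

theorem pderiv_lowComp (hy : y ∈ U) (i j : Fin 4) :
    pderiv4 i (lowComp G k j) y =
      ∑ l, (G y j l * pderiv4 i (k l) y + pderiv4 i (fun z => G z j l) y * k l y) := by
  unfold lowComp
  rw [pderiv4_sum _ fun l _ => (hK.dG hy j l).fun_mul (hK.dk hy l)]
  exact Finset.sum_congr rfl fun l _ => pderiv4_mul (hK.dG hy j l) (hK.dk hy l) i

theorem lower_covComp (hy : y ∈ U) (j i : Fin 4) :
    ∑ a, G y j a * covComp G k a i y = ∑ l, (G y j l * pderiv4 i (k l) y +
      (1 / 2 : ℝ) * (pderiv4 i (fun z => G z l j) y + pderiv4 l (fun z => G z i j) y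
        - pderiv4 j (fun z => G z i l) y) * k l y) := by
  simp only [← hK.lower_chris hy, covComp, mul_add, Finset.sum_add_distrib, Finset.mul_sum,
    Finset.sum_mul]
  congr 1
  rw [Finset.sum_comm]
  exact Finset.sum_congr rfl fun _ _ => Finset.sum_congr rfl fun _ _ => by ring

/-- For a Killing field, `dK = 2 DK`. -/
theorem curlComp_eq (hy : y ∈ U) (i j : Fin 4) :
    curlComp G k i j y = 2 * ∑ a, G y j a * covComp G k a i y := by
  -- The difference 2 D_i K_j - (∂_i K_j - ∂_j K_i) is D_i K_j + D_j K_i, that is, the (i, j)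
  -- component of £_K g.
  rw [curlComp, hK.pderiv_lowComp hy, hK.pderiv_lowComp hy, hK.lower_covComp hy,
    ← sub_eq_zero, ← neg_eq_zero, ← hK.killing y hy i j, Finset.mul_sum, ← Finset.sum_sub_distrib,
    ← Finset.sum_sub_distrib, ← Finset.sum_neg_distrib]
  refine Finset.sum_congr rfl fun l _ => ?_
  rw [hK.pderiv_G_symm hy i l j, hK.symm y hy l j]
  ring

/-- F^b{}_c = 2 D^b K_c = -2 D_c K^b by antisymmetry of DK. This trades the bivector, which involves
two inverse metrics, for the covariant derivative of K itself. -/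
theorem lower_raiseTwo (hy : y ∈ U) (b c : Fin 4) :
    ∑ d, G y c d * raiseTwo G (curlComp G k) b d y = -2 * covComp G k b c y := by
  calc ∑ d, G y c d * raiseTwo G (curlComp G k) b d y
      = ∑ i, ∑ j, (∑ d, G y c d * (G y)⁻¹ d j) * ((G y)⁻¹ b i * curlComp G k i j y) := by
        simp only [raiseTwo, Finset.mul_sum, Finset.sum_mul]
        rw [Finset.sum_comm]
        refine Finset.sum_congr rfl fun i _ => ?_
        rw [Finset.sum_comm]
        exact Finset.sum_congr rfl fun _ _ => Finset.sum_congr rfl fun _ _ => by ring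
    _ = ∑ i, (G y)⁻¹ b i * curlComp G k i c y := by simp [hK.mul_inv hy]
    _ = ∑ i, ∑ a, -2 * ((G y)⁻¹ b i * G y i a * covComp G k a c y) := by
        refine Finset.sum_congr rfl fun i _ => ?_
        rw [curlComp_antisymm, hK.curlComp_eq hy, Finset.mul_sum, ← Finset.sum_neg_distrib,
          Finset.mul_sum]
        exact Finset.sum_congr rfl fun _ _ => by ring
    _ = -2 * ∑ a, (∑ i, (G y)⁻¹ b i * G y i a) * covComp G k a c y := by
        simp only [Finset.sum_mul, Finset.mul_sum]
        exact Finset.sum_comm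
    _ = -2 * covComp G k b c y := by simp [hK.inv_mul hy]

/-- A Killing field is divergence free. -/
theorem trace_covComp (hy : y ∈ U) : ∑ b, covComp G k b b y = 0 := by
  -- The trace of DK is, up to the factor -2, the contraction of the symmetric metric with an
  -- antisymmetric bivector.
  have h : ∑ b, ∑ d, G y b d * raiseTwo G (curlComp G k) b d y = 0 :=
    sum_symm_mul_antisymm (A := fun b d => G y b d)
      (B := fun b d => raiseTwo G (curlComp G k) b d y) (hK.symm y hy) raiseTwo_antisymm
  have h' : ∑ b, ∑ d, G y b d * raiseTwo G (curlComp G k) b d y = ∑ b, -2 * covComp G k b b y :=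
    Finset.sum_congr rfl fun b _ => hK.lower_raiseTwo hy b b
  rw [h', ← Finset.mul_sum] at h
  linarith

theorem div_eq_zero (hy : y ∈ U) :
    ∑ b, pderiv4 b (k b) y + ∑ l, (∑ b, chris G b b l y) * k l y = 0 := by
  rw [← hK.trace_covComp hy]
  simp only [covComp, Finset.sum_add_distrib, Finset.sum_mul]
  rw [Finset.sum_comm (f := fun l b => chris G b b l y * k l y)]

/-- Since ∂_b t = t Γ^a_{ab}, this sum is t D_b K^b. It is the component of d⋆K. -/
theorem sum_pderiv_density_mul (hy : y ∈ U) :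
    ∑ b, pderiv4 b (fun z => t z * k b z) y = 0 := by
  have h : ∀ b, pderiv4 b (fun z => t z * k b z) y =
      t y * (pderiv4 b (k b) y + (∑ a, chris G a a b y) * k b y) := fun b => by
    rw [pderiv4_mul (hK.dt hy) (hK.dk hy b), ← hK.trace_chris hy]
    ring
  simp only [h, ← Finset.mul_sum, Finset.sum_add_distrib]
  rw [hK.div_eq_zero hy, mul_zero]

/-- The divergence vanishes on all of the open set U, so it may be differentiated. This disposes of
the term D_c D_b K^b that commuting derivatives produces. -/
theorem pderiv_div (hy : y ∈ U) (c : Fin 4) :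
    ∑ b, pderiv4 c (pderiv4 b (k b)) y + ∑ l, ((∑ b, pderiv4 c (chris G b b l) y) * k l y
      + (∑ b, chris G b b l y) * pderiv4 c (k l) y) = 0 := by
  have h : pderiv4 c (fun z => ∑ b, pderiv4 b (k b) z + ∑ l, (∑ b, chris G b b l z) * k l z) y =
      pderiv4 c (fun _ => (0 : ℝ)) y :=
    pderiv4_congr (Filter.mem_of_superset (hK.mem_nhds hy) fun z hz => hK.div_eq_zero hz) c
  have hΓ : ∀ l, DifferentiableAt ℝ (fun z => ∑ b, chris G b b l z) y := fun l =>
    DifferentiableAt.fun_sum fun b _ => (hK.smooth_chris hy b b l).differentiableAt_of_smooth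
  have hkk : ∀ b, DifferentiableAt ℝ (fun z => pderiv4 b (k b) z) y := fun b =>
    ((hK.smooth_k y hy b).pderiv4 b).differentiableAt_of_smooth
  have h0 : pderiv4 c (fun _ => (0 : ℝ)) y = 0 := by simp [pderiv4]
  rw [h0, pderiv4_add (DifferentiableAt.fun_sum fun b _ => hkk b)
    (DifferentiableAt.fun_sum fun l _ => (hΓ l).fun_mul (hK.dk hy l)), pderiv4_sum _ fun b _ => hkk b,
    pderiv4_sum _ fun l _ => (hΓ l).fun_mul (hK.dk hy l)] at h
  rw [← h]
  congr 1
  refine Finset.sum_congr rfl fun l _ => ?_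
  rw [pderiv4_mul (hΓ l) (hK.dk hy l),
    pderiv4_sum _ fun b _ => (hK.smooth_chris hy b b l).differentiableAt_of_smooth]
  ring

/-- The contracted Ricci identity for a Killing field. -/
theorem div_covComp (hy : y ∈ U) (c : Fin 4) :
    ∑ b, (pderiv4 b (covComp G k b c) y + (∑ a, chris G a a b y) * covComp G k b c y
      - ∑ f, chris G f b c y * covComp G k b f y) = -∑ l, k l y * ricciComp G l c y := by
  have h1 : ∀ b, pderiv4 b (covComp G k b c) y = pderiv4 c (pderiv4 b (k b)) y +
      ∑ l, (chris G b c l y * pderiv4 b (k l) y + pderiv4 b (chris G b c l) y * k l y) := by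
    intro b
    unfold covComp
    rw [pderiv4_add ((hK.smooth_k y hy b).pderiv4 c).differentiableAt_of_smooth
      (DifferentiableAt.fun_sum fun l _ =>
        ((hK.smooth_chris hy b c l).differentiableAt_of_smooth).fun_mul (hK.dk hy l)),
      pderiv4_sum _ fun l _ =>
        ((hK.smooth_chris hy b c l).differentiableAt_of_smooth).fun_mul (hK.dk hy l)]
    congr 1
    · exact pderiv4_comm (hK.smooth_k y hy b) b c
    · exact Finset.sum_congr rfl fun l _ =>
        pderiv4_mul (hK.smooth_chris hy b c l).differentiableAt_of_smooth (hK.dk hy l) b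
  have h2 := hK.pderiv_div hy c
  -- The terms Γ ∂K in D_b D_c K^b that are not accounted for by the differentiated divergence
  -- cancel because Γ is symmetric below; the terms Γ' K and Γ Γ K that remain form the Ricci tensor
  -- (`h4`).
  have h3 : ∑ b, ∑ f, chris G f b c y * pderiv4 f (k b) y =
      ∑ b, ∑ l, chris G b c l y * pderiv4 b (k l) y := by
    rw [Finset.sum_comm]
    refine Finset.sum_congr rfl fun f _ => Finset.sum_congr rfl fun b _ => ?_
    rw [hK.chris_symm hy]
  have h4 : ∑ l, k l y * ricciComp G l c y =
      ∑ l, (∑ b, pderiv4 c (chris G b b l) y) * k l y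
      - ∑ b, ∑ l, pderiv4 b (chris G b c l) y * k l y
      + ∑ b, ∑ f, chris G f b c y * ∑ l, chris G b f l y * k l y
      - ∑ b, (∑ a, chris G a a b y) * ∑ l, chris G b c l y * k l y := by
    have e1 : ∑ b, ∑ l, pderiv4 b (chris G b c l) y * k l y =
        ∑ l, ∑ b, pderiv4 b (chris G b c l) y * k l y := Finset.sum_comm
    have e2 : ∑ b, ∑ f, chris G f b c y * ∑ l, chris G b f l y * k l y =
        ∑ l, ∑ b, ∑ f, chris G b c f y * chris G f b l y * k l y := by
      simp only [Finset.mul_sum]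
      rw [Finset.sum_comm]
      simp only [Finset.sum_comm (s := Finset.univ (α := Fin 4)) (t := Finset.univ (α := Fin 4))
        (f := fun b l => chris G _ b c y * (chris G b _ l y * k l y))]
      rw [Finset.sum_comm]
      refine Finset.sum_congr rfl fun l _ => Finset.sum_congr rfl fun f _ =>
        Finset.sum_congr rfl fun b _ => ?_
      rw [hK.chris_symm hy f b c]
      ring
    have e3 : ∑ b, (∑ a, chris G a a b y) * ∑ l, chris G b c l y * k l y =
        ∑ l, ∑ a, ∑ b, chris G a a b y * chris G b c l y * k l y := by
      simp only [Finset.mul_sum, Finset.sum_mul]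
      rw [Finset.sum_comm]
      refine Finset.sum_congr rfl fun l _ => ?_
      rw [Finset.sum_comm]
      exact Finset.sum_congr rfl fun _ _ => Finset.sum_congr rfl fun _ _ => by ring
    rw [e1, e2, e3, ← Finset.sum_sub_distrib, ← Finset.sum_add_distrib, ← Finset.sum_sub_distrib]
    refine Finset.sum_congr rfl fun l _ => ?_
    simp only [ricciComp, Finset.sum_add_distrib, Finset.sum_sub_distrib, ← Finset.sum_mul]
    rw [Finset.sum_comm (f := fun a b => chris G a a b y * chris G b c l y)]
    ring
  rw [h4]
  simp only [h1, Finset.sum_add_distrib, Finset.sum_sub_distrib] at h2 ⊢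
  simp only [covComp, mul_add, Finset.sum_add_distrib, h3]
  linear_combination h2

/-- The divergence of the bivector of `dK` is twice the Ricci tensor applied to `K`. -/
theorem sum_pderiv_raiseTwo (hy : y ∈ U) (c : Fin 4) :
    ∑ d, G y c d * ∑ b, pderiv4 b (fun z => t z * raiseTwo G (curlComp G k) b d z) y =
      t y * (2 * ∑ l, k l y * ricciComp G l c y) := by
  set F := raiseTwo G (curlComp G k) with hF
  have hdF : ∀ b d, DifferentiableAt ℝ (F b d) y := fun b d =>
    (hK.smooth_raiseTwo hy b d).differentiableAt_of_smooth
  have htF : ∀ b d, DifferentiableAt ℝ (fun z => t z * F b d z) y := fun b d =>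
    (hK.dt hy).mul (hdF b d)
  have hN : ∀ b, DifferentiableAt ℝ (covComp G k b c) y := fun b =>
    (hK.smooth_covComp hy b c).differentiableAt_of_smooth
  -- The factor g_{cd} is moved inside the derivative, where g_{cd} F^{bd} = -2 D_c K^b; the price
  -- is the term (∂_b g_{cd}) F^{bd}.
  have h1 : ∀ b, ∑ d, G y c d * pderiv4 b (fun z => t z * F b d z) y =
      t y * (-2 * (pderiv4 b (covComp G k b c) y + (∑ a, chris G a a b y) * covComp G k b c y)
        - ∑ d, pderiv4 b (fun z => G z c d) y * F b d y) := by
    intro b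
    have e1 : pderiv4 b (fun z => ∑ d, G z c d * (t z * F b d z)) y =
        pderiv4 b (fun z => -2 * (t z * covComp G k b c z)) y := by
      refine pderiv4_congr (Filter.mem_of_superset (hK.mem_nhds hy) fun z hz => ?_) b
      change ∑ d, G z c d * (t z * F b d z) = -2 * (t z * covComp G k b c z)
      have := hK.lower_raiseTwo hz b c
      rw [show -2 * (t z * covComp G k b c z) = t z * (-2 * covComp G k b c z) by ring, ← this,
        Finset.mul_sum]
      exact Finset.sum_congr rfl fun _ _ => by ring
    rw [pderiv4_sum _ fun d _ => (hK.dG hy c d).fun_mul (htF b d),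
      pderiv4_const_mul _ ((hK.dt hy).fun_mul (hN b)), pderiv4_mul (hK.dt hy) (hN b),
      ← hK.trace_chris hy] at e1
    simp only [pderiv4_mul (hK.dG hy c _) (htF b _), Finset.sum_add_distrib] at e1
    have e2 : ∑ d, pderiv4 b (fun z => G z c d) y * (t y * F b d y) =
        t y * ∑ d, pderiv4 b (fun z => G z c d) y * F b d y := by
      rw [Finset.mul_sum]
      exact Finset.sum_congr rfl fun _ _ => by ring
    rw [e2] at e1
    linear_combination e1
  -- Contracted with the antisymmetric F^{bd}, only the part of ∂_b g_{cd} antisymmetric in b, d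
  -- survives, and this is also the antisymmetric part of g_{df} Γ^f_{bc}. The price found above is
  -- thus the connection term missing from D_b D_c K^b.
  have h2 : ∑ b, ∑ d, pderiv4 b (fun z => G z c d) y * F b d y =
      -2 * ∑ b, ∑ f, chris G f b c y * covComp G k b f y := by
    have e1 : ∑ b, ∑ d, pderiv4 c (fun z => G z b d) y * F b d y = 0 :=
      sum_symm_mul_antisymm (fun b d => hK.pderiv_G_symm hy c b d) raiseTwo_antisymm
    have e2 : ∑ b, ∑ d, (pderiv4 b (fun z => G z c d) y + pderiv4 d (fun z => G z b c) y) *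
        F b d y = 0 := by
      refine sum_symm_mul_antisymm (fun b d => ?_) raiseTwo_antisymm
      rw [hK.pderiv_G_symm hy b c d, hK.pderiv_G_symm hy d b c, add_comm]
    have e3 : ∑ b, ∑ d, (∑ f, G y d f * chris G f b c y) * F b d y =
        -2 * ∑ b, ∑ f, chris G f b c y * covComp G k b f y := by
      rw [Finset.mul_sum]
      refine Finset.sum_congr rfl fun b _ => ?_
      simp only [Finset.sum_mul]
      rw [Finset.sum_comm, Finset.mul_sum]
      refine Finset.sum_congr rfl fun f _ => ?_
      rw [show -2 * (chris G f b c y * covComp G k b f y) =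
        chris G f b c y * (-2 * covComp G k b f y) by ring, ← hK.lower_raiseTwo hy, Finset.mul_sum]
      refine Finset.sum_congr rfl fun d _ => ?_
      rw [hK.symm y hy d f]
      ring
    simp only [hK.lower_chris hy, mul_add, mul_sub, add_mul, sub_mul, Finset.sum_add_distrib,
      Finset.sum_sub_distrib, mul_assoc, ← Finset.mul_sum] at e1 e2 e3
    linear_combination e3 + (1 / 2 : ℝ) * e2 - (1 / 2 : ℝ) * e1
  calc ∑ d, G y c d * ∑ b, pderiv4 b (fun z => t z * F b d z) y
      = ∑ b, ∑ d, G y c d * pderiv4 b (fun z => t z * F b d z) y := by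
        simp only [Finset.mul_sum]
        exact Finset.sum_comm
    _ = t y * (-2 * ∑ b, (pderiv4 b (covComp G k b c) y
          + (∑ a, chris G a a b y) * covComp G k b c y
          - ∑ f, chris G f b c y * covComp G k b f y)) := by
        simp only [h1, ← Finset.mul_sum, Finset.sum_sub_distrib, h2]
        ring
    _ = t y * (2 * ∑ l, k l y * ricciComp G l c y) := by
        rw [hK.div_covComp hy]
        ring

end KillingComponents

/-! ### The Hodge star does not depend on the basis -/

theorem contractForm_succ {m k : ℕ} (u : Fin (k + 1) → E4) (α : E4 [⋀^Fin (m + k + 1)]→L[ℝ] ℝ) :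
    contractForm (m := m) u α = contractForm (m := m) (Fin.tail u) (α.curryLeft (u 0)) := rfl

theorem contractForm_add {m k : ℕ} (u : Fin k → E4) (α β : E4 [⋀^Fin (m + k)]→L[ℝ] ℝ) :
    contractForm (m := m) u (α + β) = contractForm u α + contractForm u β := by
  induction k with
  | zero => rfl
  | succ k ih =>
    exact ih (Fin.tail u) (α.curryLeft (u 0)) (β.curryLeft (u 0))

theorem contractForm_smul {m k : ℕ} (u : Fin k → E4) (c : ℝ) (α : E4 [⋀^Fin (m + k)]→L[ℝ] ℝ) :
    contractForm (m := m) u (c • α) = c • contractForm u α := by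
  induction k with
  | zero => rfl
  | succ k ih => exact ih (Fin.tail u) (α.curryLeft (u 0))

theorem contractForm_compContinuousLinearMap {m k : ℕ} (u : Fin k → E4)
    (α : E4 [⋀^Fin (m + k)]→L[ℝ] ℝ) (L : E4 →L[ℝ] E4) :
    contractForm (m := m) u (α.compContinuousLinearMap L) =
      (contractForm (fun a => L (u a)) α).compContinuousLinearMap L := by
  induction k with
  | zero => rfl
  | succ k ih =>
    rw [contractForm_succ, contractForm_succ]
    refine Eq.trans ?_ (ih (Fin.tail u) (α.curryLeft (L (u 0))))
    congr 1
    ext v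
    change α _ = α _
    congr 1
    funext i
    refine Fin.cases rfl (fun j => rfl) i

/-- The sum `∑ A(b_{i₁}, …, b_{i_k}) α(b'_{i₁}, …, b'_{i_k}, ·)`. -/
def pairedContraction (b b' : Fin 4 → E4) {m k : ℕ} (A : E4 [⋀^Fin k]→L[ℝ] ℝ)
    (α : E4 [⋀^Fin (m + k)]→L[ℝ] ℝ) : E4 [⋀^Fin m]→L[ℝ] ℝ :=
  ∑ i : Fin k → Fin 4, A (fun a => b (i a)) • contractForm (fun a => b' (i a)) α

/-- `pairedContraction` as a bilinear map. -/
def pairedContractionₗ (b b' : Fin 4 → E4) {m k : ℕ} : (E4 [⋀^Fin k]→L[ℝ] ℝ) →ₗ[ℝ]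
    (E4 [⋀^Fin (m + k)]→L[ℝ] ℝ) →ₗ[ℝ] (E4 [⋀^Fin m]→L[ℝ] ℝ) :=
  LinearMap.mk₂ ℝ (fun A α => pairedContraction b b' A α)
    (fun A A' α => by simp [pairedContraction, add_smul, Finset.sum_add_distrib])
    (fun c A α => by simp [pairedContraction, Finset.smul_sum, mul_smul])
    (fun A α α' => by simp [pairedContraction, contractForm_add, Finset.sum_add_distrib])
    (fun c A α => by
      simp only [pairedContraction, contractForm_smul, Finset.smul_sum]
      exact Finset.sum_congr rfl fun _ _ => smul_comm _ _ _)

/-- Splitting off the first index is the induction step for the independence of the basis. -/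
theorem pairedContraction_succ (b b' : Fin 4 → E4) {m k : ℕ} (A : E4 [⋀^Fin (k + 1)]→L[ℝ] ℝ)
    (α : E4 [⋀^Fin (m + k + 1)]→L[ℝ] ℝ) :
    pairedContraction (m := m) (k := k + 1) b b' A α =
      ∑ i, pairedContraction (m := m) b b' (A.curryLeft (b i)) (α.curryLeft (b' i)) := by
  unfold pairedContraction
  rw [← (Fin.consEquiv fun _ => Fin 4).sum_comp, Fintype.sum_prod_type]
  refine Finset.sum_congr rfl fun i _ => Finset.sum_congr rfl fun j _ => ?_
  congr 1
  rw [ContinuousAlternatingMap.curryLeft_apply_apply]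
  congr 1
  funext a
  refine Fin.cases rfl (fun _ => rfl) a

/-- `pairedContraction` only depends on the tensor `∑ b_i ⊗ b'_i`. -/
theorem pairedContraction_congr {b b' c c' : Fin 4 → E4} {P Q : Matrix (Fin 4) (Fin 4) ℝ}
    (hb : ∀ i, b i = ∑ j, P i j • c j) (hb' : ∀ i, b' i = ∑ j, Q i j • c' j)
    (hPQ : ∀ j l, ∑ i, P i j * Q i l = if j = l then 1 else 0) {m k : ℕ}
    (A : E4 [⋀^Fin k]→L[ℝ] ℝ) (α : E4 [⋀^Fin (m + k)]→L[ℝ] ℝ) :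
    pairedContraction b b' A α = pairedContraction c c' A α := by
  induction k with
  | zero =>
    unfold pairedContraction
    refine Finset.sum_congr rfl fun i _ => ?_
    congr 1
    exact congrArg A (Subsingleton.elim _ _)
  | succ k ih =>
    have h1 : ∀ i, A.curryLeft (b i) = ∑ j, P i j • A.curryLeft (c j) := fun i => by
      rw [hb, map_sum]
      simp only [map_smul]
    have h2 : ∀ i, ContinuousAlternatingMap.curryLeft (n := m + k) α (b' i) =
        ∑ j, Q i j • ContinuousAlternatingMap.curryLeft (n := m + k) α (c' j) := fun i => by
      rw [hb', map_sum]
      simp only [map_smul]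
    refine (pairedContraction_succ (m := m) b b' A α).trans
      (Eq.trans ?_ (pairedContraction_succ (m := m) c c' A α).symm)
    have h3 : ∀ i, pairedContraction (m := m) b b' (A.curryLeft (b i))
        (ContinuousAlternatingMap.curryLeft (n := m + k) α (b' i)) =
        ∑ j, ∑ l, (P i j * Q i l) • pairedContractionₗ c c' (m := m) (A.curryLeft (c j))
          (ContinuousAlternatingMap.curryLeft (n := m + k) α (c' l)) := fun i => by
      rw [ih]
      change pairedContractionₗ c c' (A.curryLeft (b i)) _ = _
      rw [h1, h2]
      simp only [map_sum, map_smul, LinearMap.sum_apply, LinearMap.smul_apply, Finset.smul_sum,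
        mul_smul]
      rw [Finset.sum_comm]
      exact Finset.sum_congr rfl fun _ _ => Finset.sum_congr rfl fun _ _ => smul_comm _ _ _
    rw [Finset.sum_congr rfl fun i _ => h3 i, Finset.sum_comm]
    refine Finset.sum_congr rfl fun j _ => ?_
    rw [Finset.sum_comm]
    simp only [← Finset.sum_smul, hPQ, ite_smul, one_smul, zero_smul, Finset.sum_ite_eq,
      Finset.mem_univ, if_true]
    rfl

theorem linHodgeStar_eq (g : E4 →L[ℝ] E4 →L[ℝ] ℝ) (τ : E4 [⋀^Fin 4]→L[ℝ] ℝ) {k m : ℕ}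
    (h : m + k = 4) (A : E4 [⋀^Fin k]→L[ℝ] ℝ) :
    linHodgeStar g τ h A =
      ((k.factorial : ℝ)⁻¹) • pairedContraction stdVec (recipVec g) A (castForm h τ) := rfl

theorem pairedContraction_compContinuousLinearMap (b b' : Fin 4 → E4) {m k : ℕ}
    (A : E4 [⋀^Fin k]→L[ℝ] ℝ) (α : E4 [⋀^Fin (m + k)]→L[ℝ] ℝ) (L : E4 →L[ℝ] E4) :
    pairedContraction (m := m) b b' (A.compContinuousLinearMap L) (α.compContinuousLinearMap L) =
      (pairedContraction (fun i => L (b i)) (fun i => L (b' i)) A α).compContinuousLinearMap L := by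
  ext v
  simp only [pairedContraction, contractForm_compContinuousLinearMap]
  simp [Function.comp_def]

theorem castForm_compContinuousLinearMap {n : ℕ} (h : n = 4) (τ : E4 [⋀^Fin 4]→L[ℝ] ℝ)
    (L : E4 →L[ℝ] E4) :
    castForm h (τ.compContinuousLinearMap L) = (castForm h τ).compContinuousLinearMap L := by
  subst h
  rfl

theorem sum_stdVec (v : E4) : ∑ i, v i • stdVec i = v := by
  have := (EuclideanSpace.basisFun (Fin 4) ℝ).sum_repr v
  simpa [stdVec] using this

@[simp] theorem stdVec_apply (i j : Fin 4) : stdVec i j = if j = i then 1 else 0 := by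
  simp [stdVec]

theorem apply_recipVec_stdVec {g : E4 →L[ℝ] E4 →L[ℝ] ℝ} (hg : (gramMatrix g).det ≠ 0)
    (i j : Fin 4) : g (recipVec g i) (stdVec j) = if i = j then 1 else 0 := by
  have := congrFun (congrFun (Matrix.nonsing_inv_mul (gramMatrix g) hg.isUnit) i) j
  rw [Matrix.mul_apply, Matrix.one_apply] at this
  rw [← this]
  simp [recipVec, gramMatrix]

/-- This and `sum_apply_stdVec` are the two expansions in dual bases. No symmetry of g is assumed,
so the reciprocal vector stands on the left here and the expanded vector on the left there. -/
theorem sum_apply_recipVec {g : E4 →L[ℝ] E4 →L[ℝ] ℝ} (hg : (gramMatrix g).det ≠ 0) (w : E4) :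
    ∑ i, g (recipVec g i) w • stdVec i = w := by
  conv_rhs => rw [← sum_stdVec w]
  refine Finset.sum_congr rfl fun i _ => ?_
  congr 1
  conv_lhs => rw [← sum_stdVec w]
  simp [apply_recipVec_stdVec hg]

theorem sum_apply_stdVec {g : E4 →L[ℝ] E4 →L[ℝ] ℝ} (hg : (gramMatrix g).det ≠ 0) (v : E4) :
    ∑ l, g v (stdVec l) • recipVec g l = v := by
  have key : ∀ j m, ∑ l, gramMatrix g j l * (gramMatrix g)⁻¹ l m = if j = m then 1 else 0 :=
    fun j m => by
      have := congrFun (congrFun (Matrix.mul_nonsing_inv (gramMatrix g) hg.isUnit) j) m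
      rwa [Matrix.mul_apply, Matrix.one_apply] at this
  have h1 : ∀ l, g v (stdVec l) = ∑ j, v j * gramMatrix g j l := fun l => by
    conv_lhs => rw [← sum_stdVec v]
    simp [gramMatrix]
  calc ∑ l, g v (stdVec l) • recipVec g l
      = ∑ m, (∑ j, v j * ∑ l, gramMatrix g j l * (gramMatrix g)⁻¹ l m) • stdVec m := by
        simp only [h1, recipVec, Finset.smul_sum, Finset.sum_smul, Finset.mul_sum, smul_smul]
        rw [Finset.sum_comm]
        refine Finset.sum_congr rfl fun m _ => ?_
        rw [Finset.sum_comm]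
        refine Finset.sum_congr rfl fun l _ => ?_
        rw [Finset.sum_mul, Finset.sum_smul]
        simp only [mul_assoc]
    _ = v := by simp [key, sum_stdVec]

/-- Naturality of the Hodge star under linear isomorphisms. -/
theorem linHodgeStar_compContinuousLinearMap {g g' : E4 →L[ℝ] E4 →L[ℝ] ℝ}
    (hg : (gramMatrix g).det ≠ 0) (hg' : (gramMatrix g').det ≠ 0) {L L' : E4 →L[ℝ] E4}
    (hL : ∀ v, L (L' v) = v) (hgg' : ∀ v w, g' v w = g (L v) (L w)) (τ : E4 [⋀^Fin 4]→L[ℝ] ℝ)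
    {k m : ℕ} (h : m + k = 4) (A : E4 [⋀^Fin k]→L[ℝ] ℝ) :
    linHodgeStar g' (τ.compContinuousLinearMap L) h (A.compContinuousLinearMap L) =
      (linHodgeStar g τ h A).compContinuousLinearMap L := by
  rw [linHodgeStar_eq, linHodgeStar_eq, castForm_compContinuousLinearMap,
    pairedContraction_compContinuousLinearMap]
  -- The images under L of the standard basis and of its g'-reciprocal basis are again dual with
  -- respect to g, so they define the same tensor as the standard pair for g. The duality relation
  -- is the expansion of L' ∂_l in the g'-dual bases, pushed forward by L.
  have h1 := pairedContraction_congr (b := fun i => L (stdVec i)) (b' := fun i => L (recipVec g' i))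
    (c := stdVec) (c' := recipVec g) (P := Matrix.of fun i j => (L (stdVec i)) j)
    (Q := Matrix.of fun i l => g (L (recipVec g' i)) (stdVec l))
    (fun i => (sum_stdVec _).symm) (fun i => (sum_apply_stdVec hg _).symm)
    (fun j l => by
      have e1 := congrArg L (sum_apply_recipVec hg' (L' (stdVec l)))
      rw [hL, map_sum] at e1
      have e2 := congrArg (fun v : E4 => v j) e1
      simp only [hgg', hL, map_smul, stdVec_apply] at e2
      rw [← e2]
      simp [mul_comm]) A (castForm h τ)
  rw [h1]
  rfl

/-- For symmetric `g`, the reciprocal basis may be inserted into the form instead of the volume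
form. -/
theorem linHodgeStar_eq_recipVec {g : E4 →L[ℝ] E4 →L[ℝ] ℝ} (hg : (gramMatrix g).det ≠ 0)
    (hs : ∀ v w, g v w = g w v) (τ : E4 [⋀^Fin 4]→L[ℝ] ℝ)
    {k m : ℕ} (h : m + k = 4) (A : E4 [⋀^Fin k]→L[ℝ] ℝ) :
    linHodgeStar g τ h A = ((k.factorial : ℝ)⁻¹) • ∑ i : Fin k → Fin 4,
      A (fun a => recipVec g (i a)) • contractForm (fun a => stdVec (i a)) (castForm h τ) := by
  rw [linHodgeStar_eq]
  congr 1
  refine pairedContraction_congr (P := Matrix.of fun i l => g (stdVec i) (stdVec l))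
    (Q := Matrix.of fun i l => recipVec g i l)
    (fun i => (sum_apply_stdVec hg _).symm) (fun i => (sum_stdVec _).symm) (fun j l => ?_) A _
  have e2 := congrArg (fun v : E4 => v l) (sum_apply_stdVec hg (stdVec j))
  simp only [stdVec_apply, eq_comm (a := l)] at e2
  rw [← e2]
  simp [hs _ (stdVec j)]

/-! ### Alternating symbols -/

/-- The alternating symbol. -/
def eps (a b c d : Fin 4) : ℤ :=
  -- This is a Vandermonde product: it vanishes when two indices agree and is ±12 on permutations of
  -- 0, 1, 2, 3. Integer values make the identities below decidable.
  (((b : ℤ) - a) * (c - a) * (d - a) * (c - b) * (d - b) * (d - c)) / 12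

theorem eps_perm : ∀ σ : Equiv.Perm (Fin 4),
    eps (σ 0) (σ 1) (σ 2) (σ 3) = (Equiv.Perm.sign σ : ℤ) := by decide +kernel

theorem eps_eq_zero : ∀ a b c d : Fin 4,
    (a = b ∨ a = c ∨ a = d ∨ b = c ∨ b = d ∨ c = d) → eps a b c d = 0 := by decide +kernel

theorem alternating_stdVec (τ : E4 [⋀^Fin 4]→L[ℝ] ℝ) (i : Fin 4 → Fin 4) :
    τ (fun a => stdVec (i a)) = eps (i 0) (i 1) (i 2) (i 3) * τ stdVec := by
  by_cases hi : Function.Injective i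
  · let σ : Equiv.Perm (Fin 4) := Equiv.ofBijective i (Finite.injective_iff_bijective.1 hi)
    have h1 := τ.toAlternatingMap.map_perm stdVec σ
    have h2 := eps_perm σ
    change eps (i 0) (i 1) (i 2) (i 3) = _ at h2
    change τ (fun a => stdVec (i a)) = _ at h1
    rw [h1, h2, Units.smul_def, zsmul_eq_mul]
    rfl
  · have h0 : τ (fun a => stdVec (i a)) = 0 :=
      τ.toAlternatingMap.map_eq_zero_of_not_injective (fun a => stdVec (i a)) fun h =>
        hi fun a b hab => h (by simp [hab])
    have h1 : eps (i 0) (i 1) (i 2) (i 3) = 0 := by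
      refine eps_eq_zero _ _ _ _ ?_
      by_contra hc
      push Not at hc
      obtain ⟨h01, h02, h03, h12, h13, h23⟩ := hc
      refine hi fun a b hab => ?_
      fin_cases a <;> fin_cases b <;> simp_all
    rw [h0, h1]
    simp

/-- In this and the next two identities the derivative index p of d⋆F sits in the first, second or
third slot. The sign of the middle one offsets the alternating sign of d, so the three terms
contribute equally. -/
theorem sum_eps_eps₁ : ∀ p a b l : Fin 4, ∑ j, ∑ k, eps a b j k * eps p j k l =
    2 * ((if a = p then 1 else 0) * (if b = l then 1 else 0) -
      (if b = p then 1 else 0) * (if a = l then 1 else 0)) := by decide +kernel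

theorem sum_eps_eps₂ : ∀ p a b l : Fin 4, ∑ j, ∑ k, eps a b j k * eps j p k l =
    -2 * ((if a = p then 1 else 0) * (if b = l then 1 else 0) -
      (if b = p then 1 else 0) * (if a = l then 1 else 0)) := by decide +kernel

theorem sum_eps_eps₃ : ∀ p a b l : Fin 4, ∑ j, ∑ k, eps a b j k * eps j k p l =
    2 * ((if a = p then 1 else 0) * (if b = l then 1 else 0) -
      (if b = p then 1 else 0) * (if a = l then 1 else 0)) := by decide +kernel

/-- A `4`-form on linear combinations of the standard basis. -/
theorem alternating_sum_smul_stdVec (τ : E4 [⋀^Fin 4]→L[ℝ] ℝ) (P : Matrix (Fin 4) (Fin 4) ℝ)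
    (i : Fin 4 → Fin 4) :
    τ (fun a => ∑ j, P (i a) j • stdVec j) =
      P.det * (eps (i 0) (i 1) (i 2) (i 3) * τ stdVec) := by
  let B := (EuclideanSpace.basisFun (Fin 4) ℝ).toBasis
  have hB : ∀ a, B a = stdVec a := fun a => by simp [B, stdVec]
  let R : E4 →ₗ[ℝ] E4 := B.constr ℝ fun a => ∑ j, P a j • stdVec j
  have hR : ∀ a, R (stdVec a) = ∑ j, P a j • stdVec j := fun a => by
    rw [← hB]
    exact B.constr_basis ℝ _ a
  have h1 : τ.toAlternatingMap.compLinearMap R =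
      LinearMap.det R • τ.toAlternatingMap := by
    refine Module.Basis.ext_alternating B fun v hv => ?_
    rw [AlternatingMap.compLinearMap_apply, AlternatingMap.smul_apply,
      τ.toAlternatingMap.eq_smul_basis_det B, AlternatingMap.smul_apply, AlternatingMap.smul_apply]
    have := B.det_comp R (fun a => B (v a))
    change _ • B.det (⇑R ∘ fun a => B (v a)) = _
    rw [this]
    simp only [smul_eq_mul]
    ring
  have h2 : LinearMap.det R = P.det := by
    rw [← LinearMap.det_toMatrix B, ← Matrix.det_transpose]
    congr 1
    ext a b
    rw [Matrix.transpose_apply, LinearMap.toMatrix_apply, hB, hR]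
    simp [B]
  have h3 := congrArg (fun f => f (fun a => stdVec (i a))) h1
  rw [h2] at h3
  simp only [← alternating_stdVec, ← hR]
  exact h3

/-- A `4`-form on the reciprocal basis. -/
theorem alternating_recipVec {g : E4 →L[ℝ] E4 →L[ℝ] ℝ} (τ : E4 [⋀^Fin 4]→L[ℝ] ℝ)
    (i : Fin 4 → Fin 4) :
    τ (fun a => recipVec g (i a)) =
      (gramMatrix g)⁻¹.det * (eps (i 0) (i 1) (i 2) (i 3) * τ stdVec) :=
  alternating_sum_smul_stdVec τ (gramMatrix g)⁻¹ i

/-- The determinant of the Gram matrix in terms of a unit volume form. -/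
theorem volume_sq {g : E4 →L[ℝ] E4 →L[ℝ] ℝ} {τ : E4 [⋀^Fin 4]→L[ℝ] ℝ} {b : Fin 4 → E4}
    (hb : ∀ i j, g (b i) (b j) = Matrix.diagonal ![(1 : ℝ), -1, -1, -1] i j)
    (hτ : τ b = 1 ∨ τ b = -1) :
    τ stdVec ^ 2 = -(gramMatrix g).det ∧ τ stdVec ≠ 0 ∧ (gramMatrix g).det ≠ 0 := by
  let P : Matrix (Fin 4) (Fin 4) ℝ := Matrix.of fun i j => b i j
  have h1 : P * gramMatrix g * P.transpose = Matrix.diagonal ![(1 : ℝ), -1, -1, -1] := by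
    ext i j
    rw [← hb i j, ← sum_stdVec (b i), ← sum_stdVec (b j)]
    simp only [map_sum, map_smul, _root_.sum_apply, _root_.smul_apply, smul_eq_mul,
      Matrix.mul_apply, Matrix.transpose_apply, Matrix.of_apply, P, gramMatrix]
    refine Finset.sum_congr rfl fun q _ => ?_
    rw [mul_comm]
  have h2 := congrArg Matrix.det h1
  rw [Matrix.det_mul, Matrix.det_mul, Matrix.det_transpose, Matrix.det_diagonal] at h2
  have h3 : ∏ i : Fin 4, (![(1 : ℝ), -1, -1, -1] : Fin 4 → ℝ) i = -1 := by
    simp [Fin.prod_univ_four]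
  rw [h3] at h2
  have h4 : τ b = P.det * τ stdVec := by
    have e1 : b = fun a => ∑ j, P a j • stdVec j := by
      funext a
      exact (sum_stdVec (b a)).symm
    have e2 : eps 0 1 2 3 = 1 := by decide
    have e3 := alternating_sum_smul_stdVec τ P id
    simp only [id, e2, Int.cast_one, one_mul] at e3
    conv_lhs => rw [e1]
    exact e3
  have h5 : (P.det * τ stdVec) ^ 2 = 1 := by
    rw [← h4]
    rcases hτ with h | h <;> simp [h]
  have hP : P.det ≠ 0 := fun h => by simp [h] at h2
  have ht : τ stdVec ≠ 0 := fun h => by simp [h] at h5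
  have hG : (gramMatrix g).det ≠ 0 := fun h => by simp [h] at h2
  refine ⟨?_, ht, hG⟩
  -- Taking determinants in the Gram relation gives (det P)² det g = -1, while the unit volume gives
  -- (det P · τ(∂))² = 1; the two are added.
  have h6 : P.det ^ 2 * (τ stdVec ^ 2 + (gramMatrix g).det) = 0 := by
    linear_combination h5 + h2
  have := (mul_eq_zero.1 h6).resolve_left (pow_ne_zero 2 hP)
  linarith

/-! ### The codifferential in coordinates -/

theorem sum_fin_succ_arrow {n : ℕ} {V : Type*} [AddCommMonoid V] (f : (Fin (n + 1) → Fin 4) → V) :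
    ∑ i, f i = ∑ a, ∑ i : Fin n → Fin 4, f (Matrix.vecCons a i) := by
  rw [← (Fin.consEquiv fun _ => Fin 4).sum_comp, Fintype.sum_prod_type]
  rfl

theorem sum_fin_zero_arrow {V : Type*} [AddCommMonoid V] (f : (Fin 0 → Fin 4) → V) :
    ∑ i, f i = f ![] := by
  rw [Fintype.sum_unique]
  congr 1

/-- The space of 4-forms is a line. This lets the volume form at a variable point be written as a
scalar function times the volume form at a fixed point. -/
theorem form_four_eq_smul {τ τ₀ : E4 [⋀^Fin 4]→L[ℝ] ℝ} (h : τ₀ stdVec ≠ 0) :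
    τ = (τ stdVec / τ₀ stdVec) • τ₀ := by
  refine ContinuousAlternatingMap.toAlternatingMap_injective ?_
  refine Module.Basis.ext_alternating (EuclideanSpace.basisFun (Fin 4) ℝ).toBasis fun v _ => ?_
  have hB : ∀ a, (EuclideanSpace.basisFun (Fin 4) ℝ).toBasis a = stdVec a := fun a => by
    simp [stdVec]
  simp only [hB]
  change τ (fun a => stdVec (v a)) = _ * τ₀ (fun a => stdVec (v a))
  rw [alternating_stdVec τ v, alternating_stdVec τ₀ v]
  field_simp

theorem form_four_ext {φ : E4 [⋀^Fin 4]→L[ℝ] ℝ} (h : φ stdVec = 0) : φ = 0 := by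
  refine ContinuousAlternatingMap.toAlternatingMap_injective ?_
  refine Module.Basis.ext_alternating (EuclideanSpace.basisFun (Fin 4) ℝ).toBasis fun v _ => ?_
  have hB : ∀ a, (EuclideanSpace.basisFun (Fin 4) ℝ).toBasis a = stdVec a := fun a => by
    simp [stdVec]
  simp only [hB]
  change φ (fun a => stdVec (v a)) = 0
  rw [alternating_stdVec φ v, h, mul_zero]

theorem one_form_ext {α β : E4 [⋀^Fin 1]→L[ℝ] ℝ}
    (h : ∀ i, α (fun _ => stdVec i) = β (fun _ => stdVec i)) : α = β := by
  refine ContinuousAlternatingMap.toAlternatingMap_injective ?_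
  refine Module.Basis.ext_alternating (EuclideanSpace.basisFun (Fin 4) ℝ).toBasis fun v _ => ?_
  have hB : ∀ a, (EuclideanSpace.basisFun (Fin 4) ℝ).toBasis a = stdVec a := fun a => by
    simp [stdVec]
  simp only [hB]
  have hv : v = fun _ => v 0 := by
    funext a
    rw [Subsingleton.elim a 0]
  rw [hv]
  exact h (v 0)

theorem one_form_map_sum (α : E4 [⋀^Fin 1]→L[ℝ] ℝ) (c : Fin 4 → ℝ) (u : Fin 4 → E4) :
    α (fun _ => ∑ j, c j • u j) = ∑ j, c j * α (fun _ => u j) := by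
  let l : E4 →L[ℝ] ℝ := (ContinuousAlternatingMap.ofSubsingleton ℝ E4 ℝ (0 : Fin 1)).symm α
  have hl : ∀ v, α (fun _ => v) = l v := fun v => rfl
  simp [hl]

theorem two_form_map_sum (F : E4 [⋀^Fin 2]→L[ℝ] ℝ) (c d : Fin 4 → ℝ) (u : Fin 4 → E4) :
    F ![∑ i, c i • u i, ∑ j, d j • u j] = ∑ i, ∑ j, c i * d j * F ![u i, u j] := by
  have h1 : F ![∑ i, c i • u i, ∑ j, d j • u j] =
      F.curryLeft (∑ i, c i • u i) (fun _ => ∑ j, d j • u j) := by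
    rw [ContinuousAlternatingMap.curryLeft_apply_apply]
    congr 1
    funext a
    fin_cases a <;> rfl
  have h2 : ∀ i j, F ![u i, u j] = F.curryLeft (u i) (fun _ => u j) := fun i j => by
    rw [ContinuousAlternatingMap.curryLeft_apply_apply]
    congr 1
    funext a
    fin_cases a <;> rfl
  rw [h1, one_form_map_sum]
  simp only [h2, map_sum, map_smul, ContinuousAlternatingMap.sum_apply,
    ContinuousAlternatingMap.smul_apply, smul_eq_mul, Finset.mul_sum]
  rw [Finset.sum_comm]
  exact Finset.sum_congr rfl fun _ _ => Finset.sum_congr rfl fun _ _ => by ring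

section ChartComponents

variable {U : Set E4} {g : E4 → E4 →L[ℝ] E4 →L[ℝ] ℝ} {τ : E4 → E4 [⋀^Fin 4]→L[ℝ] ℝ}
  {k : Fin 4 → E4 → ℝ}

namespace KillingComponents

variable (hK : KillingComponents U (fun y => gramMatrix (g y)) (fun y => τ y stdVec) k) {y : E4}

include hK

theorem symm_form (hy : y ∈ U) (v w : E4) : g y v w = g y w v := by
  rw [← sum_stdVec v, ← sum_stdVec w]
  simp only [map_sum, map_smul, _root_.sum_apply, _root_.smul_apply,
    smul_eq_mul, Finset.mul_sum]
  rw [Finset.sum_comm]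
  refine Finset.sum_congr rfl fun i _ => Finset.sum_congr rfl fun j _ => ?_
  have := hK.symm y hy i j
  simp only [gramMatrix, Matrix.of_apply] at this
  rw [this]
  ring

theorem oneForm_recipVec (hy : y ∈ U) {A : E4 [⋀^Fin 1]→L[ℝ] ℝ}
    (hA : ∀ j, A (fun _ => stdVec j) = lowComp (fun y => gramMatrix (g y)) k j y) (i : Fin 4) :
    A (fun _ => recipVec (g y) i) = k i y := by
  rw [recipVec, one_form_map_sum]
  simp only [hA, lowComp, Finset.mul_sum]
  rw [Finset.sum_comm]
  simp only [← mul_assoc, ← Finset.sum_mul, hK.inv_mul hy]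
  simp

omit hK in
theorem twoForm_recipVec {F : E4 [⋀^Fin 2]→L[ℝ] ℝ}
    (hF : ∀ i j, F ![stdVec i, stdVec j] = curlComp (fun y => gramMatrix (g y)) k i j y)
    (b d : Fin 4) :
    F ![recipVec (g y) b, recipVec (g y) d] =
      raiseTwo (fun y => gramMatrix (g y)) (curlComp (fun y => gramMatrix (g y)) k) b d y := by
  rw [recipVec, recipVec, two_form_map_sum]
  simp only [hF, raiseTwo]

/-- With the reciprocal vectors inserted in A, the coefficients are the contravariant components
k^p. Referring τ to a fixed point y₀ puts all dependence on y into scalar coefficients of constant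
3-forms, so ⋆A can be differentiated through these scalars. `star_twoForm` does the same in degree
two. -/
theorem star_oneForm (y₀ : E4) (hy₀ : y₀ ∈ U) (hy : y ∈ U) {A : E4 [⋀^Fin 1]→L[ℝ] ℝ}
    (hA : ∀ j, A (fun _ => stdVec j) = lowComp (fun y => gramMatrix (g y)) k j y) :
    linHodgeStar (g y) (τ y) (m := 3) rfl A = ∑ p, (τ y stdVec * k p y / τ y₀ stdVec) •
      contractForm (m := 3) (fun _ : Fin 1 => stdVec p) (τ y₀) := by
  rw [linHodgeStar_eq_recipVec (hK.det_ne hy) (hK.symm_form hy), sum_fin_succ_arrow]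
  simp only [sum_fin_zero_arrow, Nat.factorial, Nat.cast_one, inv_one, one_smul, mul_one]
  refine Finset.sum_congr rfl fun p _ => ?_
  have h1 : (fun a : Fin 1 => recipVec (g y) (Matrix.vecCons p ![] a)) =
      fun _ => recipVec (g y) p := by
    funext a
    rw [Subsingleton.elim a 0]
    rfl
  have h2 : (fun a : Fin 1 => stdVec (Matrix.vecCons p ![] a)) = fun _ => stdVec p := by
    funext a
    rw [Subsingleton.elim a 0]
    rfl
  rw [h1, h2, hK.oneForm_recipVec hy hA]
  change k p y • contractForm (m := 3) (k := 1) _ (τ y) = _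
  conv_lhs => rw [form_four_eq_smul (τ := τ y) (hK.t_ne y₀ hy₀)]
  rw [contractForm_smul (m := 3) (k := 1), smul_smul]
  congr 1
  ring

theorem star_twoForm (y₀ : E4) (hy₀ : y₀ ∈ U) (hy : y ∈ U) {F : E4 [⋀^Fin 2]→L[ℝ] ℝ}
    (hF : ∀ i j, F ![stdVec i, stdVec j] = curlComp (fun y => gramMatrix (g y)) k i j y) :
    linHodgeStar (g y) (τ y) (m := 2) rfl F = ∑ p, ∑ q, ((1 / 2 : ℝ) * (τ y stdVec *
      raiseTwo (fun y => gramMatrix (g y)) (curlComp (fun y => gramMatrix (g y)) k) p q y)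
        / τ y₀ stdVec) • contractForm (m := 2) ![stdVec p, stdVec q] (τ y₀) := by
  rw [linHodgeStar_eq_recipVec (hK.det_ne hy) (hK.symm_form hy), sum_fin_succ_arrow,
    Finset.smul_sum]
  refine Finset.sum_congr rfl fun p _ => ?_
  rw [sum_fin_succ_arrow, Finset.smul_sum]
  refine Finset.sum_congr rfl fun q _ => ?_
  rw [sum_fin_zero_arrow]
  have h1 : (fun a : Fin 2 => recipVec (g y) (Matrix.vecCons p ![q] a)) =
      ![recipVec (g y) p, recipVec (g y) q] := by
    funext a
    fin_cases a <;> rfl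
  have h2 : (fun a : Fin 2 => stdVec (Matrix.vecCons p ![q] a)) = ![stdVec p, stdVec q] := by
    funext a
    fin_cases a <;> rfl
  rw [h1, h2, twoForm_recipVec hF]
  change _ • _ • contractForm (m := 2) (k := 2) _ (τ y) = _
  conv_lhs => rw [form_four_eq_smul (τ := τ y) (hK.t_ne y₀ hy₀)]
  rw [contractForm_smul (m := 2) (k := 2), smul_smul, smul_smul]
  congr 1
  simp only [Nat.factorial, Nat.cast_succ, Nat.cast_zero]
  ring

theorem eventually_mem (hy : y ∈ U) : ∀ᶠ z in nhds y, z ∈ U := hK.mem_nhds hy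

theorem differentiableAt_star_oneForm (hy : y ∈ U) {A : E4 → E4 [⋀^Fin 1]→L[ℝ] ℝ}
    (hA : ∀ z ∈ U, ∀ j, A z (fun _ => stdVec j) = lowComp (fun y => gramMatrix (g y)) k j z) :
    DifferentiableAt ℝ (fun z => linHodgeStar (g z) (τ z) (m := 3) rfl (A z)) y := by
  have h : DifferentiableAt ℝ (fun z => ∑ p, (τ z stdVec * k p z / τ y stdVec) •
      contractForm (m := 3) (fun _ : Fin 1 => stdVec p) (τ y)) y :=
    DifferentiableAt.fun_sum fun p _ => by
      have h1 : DifferentiableAt ℝ (fun z => τ z stdVec * k p z) y :=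
        (hK.dt hy).fun_mul (hK.dk hy p)
      simp only [div_eq_mul_inv]
      exact (h1.mul_const _).smul_const _
  refine h.congr_of_eventuallyEq ?_
  filter_upwards [hK.eventually_mem hy] with z hz
  exact hK.star_oneForm y hy hz (hA z hz)

theorem differentiableAt_star_twoForm (hy : y ∈ U) {F : E4 → E4 [⋀^Fin 2]→L[ℝ] ℝ}
    (hF : ∀ z ∈ U, ∀ i j, F z ![stdVec i, stdVec j] =
      curlComp (fun y => gramMatrix (g y)) k i j z) :
    DifferentiableAt ℝ (fun z => linHodgeStar (g z) (τ z) (m := 2) rfl (F z)) y := by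
  have h : DifferentiableAt ℝ (fun z => ∑ p, ∑ q, ((1 / 2 : ℝ) * (τ z stdVec *
      raiseTwo (fun y => gramMatrix (g y)) (curlComp (fun y => gramMatrix (g y)) k) p q z)
        / τ y stdVec) • contractForm (m := 2) ![stdVec p, stdVec q] (τ y)) y :=
    DifferentiableAt.fun_sum fun p _ => DifferentiableAt.fun_sum fun q _ => by
      have h1 := (hK.dt hy).fun_mul (hK.smooth_raiseTwo hy p q).differentiableAt_of_smooth
      simp only [div_eq_mul_inv]
      exact ((h1.const_mul _).mul_const _).smul_const _
  refine h.congr_of_eventuallyEq ?_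
  filter_upwards [hK.eventually_mem hy] with z hz
  exact hK.star_twoForm y hy hz (hF z hz)

theorem star_oneForm_apply (hy : y ∈ U) {A : E4 [⋀^Fin 1]→L[ℝ] ℝ}
    (hA : ∀ j, A (fun _ => stdVec j) = lowComp (fun y => gramMatrix (g y)) k j y)
    (w : Fin 3 → Fin 4) :
    linHodgeStar (g y) (τ y) (m := 3) rfl A (fun a => stdVec (w a)) =
      ∑ p, (eps p (w 0) (w 1) (w 2) : ℝ) * (τ y stdVec * k p y) := by
  rw [hK.star_oneForm y hy hy hA, ContinuousAlternatingMap.sum_apply]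
  refine Finset.sum_congr rfl fun p _ => ?_
  rw [ContinuousAlternatingMap.smul_apply]
  have h1 : contractForm (m := 3) (fun _ : Fin 1 => stdVec p) (τ y) (fun a => stdVec (w a)) =
      τ y (fun a => stdVec (Matrix.vecCons p w a)) := by
    change τ y _ = τ y _
    congr 1
    funext a
    refine Fin.cases rfl (fun _ => rfl) a
  rw [h1, alternating_stdVec (τ y) (Matrix.vecCons p w), smul_eq_mul]
  change _ * ((eps p (w 0) (w 1) (w 2) : ℝ) * _) = _
  have := hK.t_ne y hy
  field_simp

theorem star_twoForm_apply (hy : y ∈ U) {F : E4 [⋀^Fin 2]→L[ℝ] ℝ}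
    (hF : ∀ i j, F ![stdVec i, stdVec j] = curlComp (fun y => gramMatrix (g y)) k i j y)
    (w : Fin 2 → Fin 4) :
    linHodgeStar (g y) (τ y) (m := 2) rfl F (fun a => stdVec (w a)) =
      ∑ p, ∑ q, (1 / 2 : ℝ) * eps p q (w 0) (w 1) * (τ y stdVec *
        raiseTwo (fun y => gramMatrix (g y)) (curlComp (fun y => gramMatrix (g y)) k) p q y) := by
  rw [hK.star_twoForm y hy hy hF, ContinuousAlternatingMap.sum_apply]
  refine Finset.sum_congr rfl fun p _ => ?_
  rw [ContinuousAlternatingMap.sum_apply]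
  refine Finset.sum_congr rfl fun q _ => ?_
  rw [ContinuousAlternatingMap.smul_apply]
  have h1 : contractForm (m := 2) ![stdVec p, stdVec q] (τ y) (fun a => stdVec (w a)) =
      τ y (fun a => stdVec (Matrix.vecCons p (Matrix.vecCons q w) a)) := by
    change τ y _ = τ y _
    congr 1
    funext a
    refine Fin.cases rfl (fun b => Fin.cases rfl (fun _ => rfl) b) a
  rw [h1, alternating_stdVec (τ y) (Matrix.vecCons p (Matrix.vecCons q w)), smul_eq_mul]
  change _ * ((eps p q (w 0) (w 1) : ℝ) * _) = _
  have := hK.t_ne y hy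
  field_simp

/-- `⋆A` is closed if `A` is the `1`-form of a Killing field. -/
theorem extDeriv_star_oneForm (hy : y ∈ U) {A : E4 → E4 [⋀^Fin 1]→L[ℝ] ℝ}
    (hA : ∀ z ∈ U, ∀ j, A z (fun _ => stdVec j) = lowComp (fun y => gramMatrix (g y)) k j z) :
    extDeriv (fun z => linHodgeStar (g z) (τ z) (m := 3) rfl (A z)) y = 0 := by
  refine form_four_ext ?_
  rw [extDeriv_apply (hK.differentiableAt_star_oneForm hy hA)]
  have h1 : ∀ a : Fin 4, fderiv ℝ (fun z => linHodgeStar (g z) (τ z) (m := 3) rfl (A z)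
      (a.removeNth stdVec)) y (stdVec a) =
      ∑ p, (eps p (a.succAbove 0) (a.succAbove 1) (a.succAbove 2) : ℝ) *
        pderiv4 a (fun z => τ z stdVec * k p z) y := fun a => by
    have hd : ∀ p, DifferentiableAt ℝ (fun z => τ z stdVec * k p z) y := fun p =>
      (hK.dt hy).fun_mul (hK.dk hy p)
    simp only [← pderiv4_const_mul _ (hd _)]
    rw [← pderiv4_sum _ fun p _ => (hd p).const_mul _]
    refine pderiv4_congr ?_ a
    filter_upwards [hK.eventually_mem hy] with z hz
    exact hK.star_oneForm_apply hz (hA z hz) fun b => a.succAbove b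
  -- The index p must be the one omitted by `succAbove`; moving it back into place costs (-1)^a,
  -- which cancels the sign in d. Only the divergence remains.
  have h2 : ∀ a p : Fin 4, (-1) ^ a.val * eps p (a.succAbove 0) (a.succAbove 1) (a.succAbove 2) =
      if a = p then 1 else 0 := by decide +kernel
  have h3 : ∀ a p : Fin 4, ((-1 : ℝ)) ^ a.val *
      (eps p (a.succAbove 0) (a.succAbove 1) (a.succAbove 2) : ℝ) =
      if a = p then 1 else 0 := fun a p => by
    have := congrArg (Int.cast : ℤ → ℝ) (h2 a p)
    push_cast at this
    exact this
  rw [← hK.sum_pderiv_density_mul hy]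
  refine Finset.sum_congr rfl fun a _ => ?_
  rw [h1, zsmul_eq_mul, Finset.mul_sum]
  push_cast
  simp only [← mul_assoc, h3]
  simp

/-- The `3`-form `d⋆F` for `F = dK`. -/
theorem extDeriv_star_twoForm_apply (hy : y ∈ U) {F : E4 → E4 [⋀^Fin 2]→L[ℝ] ℝ}
    (hF : ∀ z ∈ U, ∀ i j, F z ![stdVec i, stdVec j] =
      curlComp (fun y => gramMatrix (g y)) k i j z) (a b c : Fin 4) :
    extDeriv (fun z => linHodgeStar (g z) (τ z) (m := 2) rfl (F z)) y
        ![stdVec a, stdVec b, stdVec c] =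
      ∑ p, ∑ q, (1 / 2 : ℝ) *
        (eps p q b c * pderiv4 a (fun z => τ z stdVec * raiseTwo (fun y => gramMatrix (g y))
          (curlComp (fun y => gramMatrix (g y)) k) p q z) y
        - eps p q a c * pderiv4 b (fun z => τ z stdVec * raiseTwo (fun y => gramMatrix (g y))
          (curlComp (fun y => gramMatrix (g y)) k) p q z) y
        + eps p q a b * pderiv4 c (fun z => τ z stdVec * raiseTwo (fun y => gramMatrix (g y))
          (curlComp (fun y => gramMatrix (g y)) k) p q z) y) := by
  set T : Fin 4 → Fin 4 → E4 → ℝ := fun p q z => τ z stdVec *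
    raiseTwo (fun y => gramMatrix (g y)) (curlComp (fun y => gramMatrix (g y)) k) p q z with hT
  have hd : ∀ p q, DifferentiableAt ℝ (T p q) y := fun p q =>
    (hK.dt hy).fun_mul (hK.smooth_raiseTwo hy p q).differentiableAt_of_smooth
  have h1 : ∀ (r s u : Fin 4) (v : Fin 2 → E4), v = ![stdVec s, stdVec u] →
      fderiv ℝ (fun z => linHodgeStar (g z) (τ z) (m := 2) rfl (F z) v) y (stdVec r) =
      ∑ p, ∑ q, (1 / 2 : ℝ) * eps p q s u * pderiv4 r (T p q) y := by
    intro r s u v hv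
    have hv' : v = fun i => stdVec (![s, u] i) := by
      rw [hv]
      funext i
      fin_cases i <;> rfl
    simp only [← pderiv4_const_mul _ (hd _ _)]
    have e1 : ∀ p, ∑ q, pderiv4 r (fun z => (1 / 2 : ℝ) * eps p q s u * T p q z) y =
        pderiv4 r (fun z => ∑ q, (1 / 2 : ℝ) * eps p q s u * T p q z) y := fun p =>
      (pderiv4_sum _ (fun q _ => (hd p q).const_mul _) r).symm
    rw [Finset.sum_congr rfl fun p _ => e1 p, ← pderiv4_sum _ fun p _ =>
      DifferentiableAt.fun_sum fun q _ => (hd p q).const_mul _]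
    refine pderiv4_congr ?_ r
    filter_upwards [hK.eventually_mem hy] with z hz
    rw [hv']
    exact hK.star_twoForm_apply hz (hF z hz) ![s, u]
  rw [extDeriv_apply (hK.differentiableAt_star_twoForm hy hF), Fin.sum_univ_three]
  have e0 := h1 a b c ((0 : Fin 3).removeNth ![stdVec a, stdVec b, stdVec c])
    (by funext i; fin_cases i <;> rfl)
  have e1 := h1 b a c ((1 : Fin 3).removeNth ![stdVec a, stdVec b, stdVec c])
    (by funext i; fin_cases i <;> rfl)
  have e2 := h1 c a b ((2 : Fin 3).removeNth ![stdVec a, stdVec b, stdVec c])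
    (by funext i; fin_cases i <;> rfl)
  change (-1) ^ 0 • fderiv ℝ _ y (stdVec a) + (-1) ^ 1 • fderiv ℝ _ y (stdVec b) +
    (-1) ^ 2 • fderiv ℝ _ y (stdVec c) = _
  rw [e0, e1, e2]
  simp only [zsmul_eq_mul, Finset.mul_sum, ← Finset.sum_add_distrib]
  refine Finset.sum_congr rfl fun p _ => Finset.sum_congr rfl fun q _ => ?_
  norm_num
  ring

/-- The codifferential `⋆⁻¹ d ⋆ dK` of the field of a Killing vector field. -/
theorem star_extDeriv_star_twoForm (hy : y ∈ U) {F : E4 → E4 [⋀^Fin 2]→L[ℝ] ℝ}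
    (hF : ∀ z ∈ U, ∀ i j, F z ![stdVec i, stdVec j] =
      curlComp (fun y => gramMatrix (g y)) k i j z) (c : Fin 4) :
    linHodgeStar (g y) (τ y) (m := 1) rfl
        (extDeriv (fun z => linHodgeStar (g z) (τ z) (m := 2) rfl (F z)) y) (fun _ => stdVec c) =
      -(2 * ∑ l, k l y * ricciComp (fun y => gramMatrix (g y)) l c y) := by
  set G : E4 → Matrix (Fin 4) (Fin 4) ℝ := fun y => gramMatrix (g y) with hG
  set dT : Fin 4 → Fin 4 → Fin 4 → ℝ := fun r p q =>
    pderiv4 r (fun z => τ z stdVec * raiseTwo G (curlComp G k) p q z) y with hdT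
  have hanti : ∀ r p q, dT r p q = -dT r q p := fun r p q => by
    have : (fun z => τ z stdVec * raiseTwo G (curlComp G k) p q z) =
        fun z => (-1) * (τ z stdVec * raiseTwo G (curlComp G k) q p z) := by
      funext z
      rw [raiseTwo_antisymm]
      ring
    simp only [hdT]
    rw [this, pderiv4_const_mul _ ((hK.dt hy).fun_mul
      (hK.smooth_raiseTwo hy q p).differentiableAt_of_smooth)]
    ring
  have hφ := hK.extDeriv_star_twoForm_apply hy hF
  set φ := extDeriv (fun z => linHodgeStar (g z) (τ z) (m := 2) rfl (F z)) y with hφdef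
  have hφ' : ∀ a b d, φ ![stdVec a, stdVec b, stdVec d] = ∑ p, ∑ q, (1 / 2 : ℝ) *
      (eps p q b d * dT a p q - eps p q a d * dT b p q + eps p q a b * dT d p q) := hφ
  have hR : ∀ (i : Fin 3 → Fin 4), contractForm (m := 1) (fun a => recipVec (g y) (i a)) (τ y)
      (fun _ => stdVec c) = ∑ l, G y c l * ((G y)⁻¹.det *
        (eps (i 0) (i 1) (i 2) l * τ y stdVec)) := fun i => by
    -- Writing ∂_c = g_{cl} ∂^l puts reciprocal vectors in all four slots of τ, so its value is det
    -- G⁻¹ times an alternating symbol.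
    rw [← sum_apply_stdVec (hK.det_ne hy) (stdVec c), one_form_map_sum]
    refine Finset.sum_congr rfl fun l _ => ?_
    have h1 : contractForm (m := 1) (fun a => recipVec (g y) (i a)) (τ y)
        (fun _ => recipVec (g y) l) =
        τ y (fun a => recipVec (g y) (![i 0, i 1, i 2, l] a)) := by
      change τ y _ = τ y _
      congr 1
      funext a
      fin_cases a <;> rfl
    rw [h1, alternating_recipVec]
    rfl
  -- Each of the three terms of d contributes the same multiple of the divergence, and so does each
  -- half of the antisymmetrisation in p, q. The resulting 6 cancels the 1/3! in the star of a
  -- 3-form.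
  have hsum : ∀ l, ∑ a, ∑ b, ∑ d, φ ![stdVec a, stdVec b, stdVec d] * (eps a b d l : ℝ) =
      6 * ∑ b, dT b b l := by
    intro l
    have s1 : ∀ p q r : Fin 4, ∑ j, ∑ m, (eps p q j m : ℝ) * eps r j m l =
        2 * ((if p = r then 1 else 0) * (if q = l then 1 else 0) -
          (if q = r then 1 else 0) * (if p = l then 1 else 0)) := fun p q r => by
      have := congrArg (Int.cast : ℤ → ℝ) (sum_eps_eps₁ r p q l)
      push_cast at this
      exact this
    have s2 : ∀ p q r : Fin 4, ∑ j, ∑ m, (eps p q j m : ℝ) * eps j r m l =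
        -2 * ((if p = r then 1 else 0) * (if q = l then 1 else 0) -
          (if q = r then 1 else 0) * (if p = l then 1 else 0)) := fun p q r => by
      have := congrArg (Int.cast : ℤ → ℝ) (sum_eps_eps₂ r p q l)
      push_cast at this
      exact this
    have s3 : ∀ p q r : Fin 4, ∑ j, ∑ m, (eps p q j m : ℝ) * eps j m r l =
        2 * ((if p = r then 1 else 0) * (if q = l then 1 else 0) -
          (if q = r then 1 else 0) * (if p = l then 1 else 0)) := fun p q r => by
      have := congrArg (Int.cast : ℤ → ℝ) (sum_eps_eps₃ r p q l)
      push_cast at this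
      exact this
    have key : ∀ f : Fin 4 → Fin 4 → Fin 4 → Fin 4 → Fin 4 → ℝ,
        ∑ a, ∑ b, ∑ d, ∑ p, ∑ q, f a b d p q = ∑ p, ∑ q, ∑ a, ∑ b, ∑ d, f a b d p q := fun f => by
      simp only [← Fintype.sum_prod_type']
      exact Fintype.sum_equiv ⟨fun x => (x.2.2.2.1, x.2.2.2.2, x.1, x.2.1, x.2.2.1),
        fun x => (x.2.2.1, x.2.2.2.1, x.2.2.2.2, x.1, x.2.1), fun _ => rfl, fun _ => rfl⟩
        _ _ fun _ => rfl
    have e1 : ∀ p q, ∑ a, ∑ b, ∑ d, (eps p q b d * dT a p q) * (eps a b d l : ℝ) =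
        ∑ r, dT r p q * ∑ j, ∑ m, (eps p q j m : ℝ) * eps r j m l := fun p q => by
      simp only [Finset.mul_sum]
      exact Finset.sum_congr rfl fun _ _ => Finset.sum_congr rfl fun _ _ =>
        Finset.sum_congr rfl fun _ _ => by ring
    have e2 : ∀ p q, ∑ a, ∑ b, ∑ d, (eps p q a d * dT b p q) * (eps a b d l : ℝ) =
        ∑ r, dT r p q * ∑ j, ∑ m, (eps p q j m : ℝ) * eps j r m l := fun p q => by
      rw [Finset.sum_comm]
      simp only [Finset.mul_sum]
      exact Finset.sum_congr rfl fun _ _ => Finset.sum_congr rfl fun _ _ =>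
        Finset.sum_congr rfl fun _ _ => by ring
    have e3 : ∀ p q, ∑ a, ∑ b, ∑ d, (eps p q a b * dT d p q) * (eps a b d l : ℝ) =
        ∑ r, dT r p q * ∑ j, ∑ m, (eps p q j m : ℝ) * eps j m r l := fun p q => by
      simp only [Finset.mul_sum]
      rw [Finset.sum_congr rfl fun a _ => Finset.sum_comm, Finset.sum_comm]
      exact Finset.sum_congr rfl fun _ _ => Finset.sum_congr rfl fun _ _ =>
        Finset.sum_congr rfl fun _ _ => by ring
    have e4 : ∀ p q, ∑ r, dT r p q * (2 * ((if p = r then 1 else 0) * (if q = l then 1 else 0) -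
          (if q = r then 1 else 0) * (if p = l then 1 else 0))) =
        2 * ((if q = l then dT p p q else 0) - (if p = l then dT q p q else 0)) := fun p q => by
      simp only [mul_sub, Finset.sum_sub_distrib, mul_ite, mul_one, mul_zero]
      split_ifs <;> simp <;> ring
    have e5 : ∀ p q, ∑ a, ∑ b, ∑ d, (1 / 2 : ℝ) *
        (eps p q b d * dT a p q - eps p q a d * dT b p q + eps p q a b * dT d p q) * eps a b d l =
        3 * ((if q = l then dT p p q else 0) - (if p = l then dT q p q else 0)) := fun p q => by
      have : ∀ a b d, (1 / 2 : ℝ) * (eps p q b d * dT a p q - eps p q a d * dT b p q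
          + eps p q a b * dT d p q) * eps a b d l =
          (1 / 2 : ℝ) * ((eps p q b d * dT a p q) * (eps a b d l : ℝ)
            - (eps p q a d * dT b p q) * (eps a b d l : ℝ)
            + (eps p q a b * dT d p q) * (eps a b d l : ℝ)) := fun a b d => by ring
      simp only [this, ← Finset.mul_sum, Finset.sum_add_distrib, Finset.sum_sub_distrib, e1, e2, e3,
        s1, s2, s3]
      simp only [neg_mul, mul_neg, Finset.sum_neg_distrib, e4]
      ring
    simp only [hφ', Finset.sum_mul]
    rw [key]
    simp only [e5, ← Finset.mul_sum, Finset.sum_sub_distrib]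
    rw [Finset.sum_comm (f := fun p q => if p = l then dT q p q else 0)]
    simp only [Finset.sum_ite_eq', Finset.mem_univ, if_true]
    rw [Finset.sum_congr rfl fun r _ => hanti r l r, Finset.sum_neg_distrib]
    ring
  -- Here the Lorentzian sign det G = -t² enters and gives the overall minus of ⋆d⋆F.
  have hdet : (G y)⁻¹.det * τ y stdVec = -(τ y stdVec)⁻¹ := by
    have h1 := hK.t_sq y hy
    have h2 := hK.t_ne y hy
    have h3 : (G y).det = -(τ y stdVec) ^ 2 := by
      linear_combination h1
    rw [Matrix.det_nonsing_inv, Ring.inverse_eq_inv', h3]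
    field_simp
  have hfin := hK.sum_pderiv_raiseTwo hy c
  have hL : linHodgeStar (g y) (τ y) (m := 1) rfl φ (fun _ => stdVec c) =
      (1 / 6 : ℝ) * ∑ a, ∑ b, ∑ d, φ ![stdVec a, stdVec b, stdVec d] *
        ∑ l, G y c l * ((G y)⁻¹.det * (eps a b d l * τ y stdVec)) := by
    rw [linHodgeStar]
    simp only [ContinuousAlternatingMap.smul_apply, ContinuousAlternatingMap.sum_apply]
    simp only [sum_fin_succ_arrow, sum_fin_zero_arrow, smul_eq_mul]
    congr 1
    · norm_num [Nat.factorial]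
    · refine Finset.sum_congr rfl fun a _ => Finset.sum_congr rfl fun b _ =>
        Finset.sum_congr rfl fun d _ => ?_
      congr 1
      · congr 1
        funext i
        fin_cases i <;> rfl
      · exact hR ![a, b, d]
  rw [hL]
  have hswap : ∑ a, ∑ b, ∑ d, φ ![stdVec a, stdVec b, stdVec d] *
        ∑ l, G y c l * ((G y)⁻¹.det * (eps a b d l * τ y stdVec)) =
      ∑ l, G y c l * ((G y)⁻¹.det * τ y stdVec) *
        ∑ a, ∑ b, ∑ d, φ ![stdVec a, stdVec b, stdVec d] * (eps a b d l : ℝ) := by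
    simp only [Finset.mul_sum]
    simp only [← Fintype.sum_prod_type']
    exact Fintype.sum_equiv ⟨fun x => (x.2.2.2, x.1, x.2.1, x.2.2.1),
      fun x => (x.2.1, x.2.2.1, x.2.2.2, x.1), fun _ => rfl, fun _ => rfl⟩ _ _ fun _ => by
        simp only [Equiv.coe_fn_mk]
        ring
  rw [hswap]
  simp only [hsum, hdet]
  have hfin' : ∑ d, G y c d * ∑ b, dT b b d =
      τ y stdVec * (2 * ∑ l, k l y * ricciComp G l c y) := hfin
  have h4 : ∑ l, G y c l * -(τ y stdVec)⁻¹ * (6 * ∑ b, dT b b l) =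
      -6 * (τ y stdVec)⁻¹ * ∑ l, G y c l * ∑ b, dT b b l := by
    rw [Finset.mul_sum]
    exact Finset.sum_congr rfl fun _ _ => by ring
  rw [h4, hfin']
  have := hK.t_ne y hy
  field_simp

end KillingComponents

end ChartComponents

/-! ### Passing to a chart -/

section Chart

open Bundle

variable {M : Type*} [TopologicalSpace M] [ChartedSpace E4 M]

/-- The derivative of a chart as an endomorphism of the model space. -/
def chartDeriv (e : OpenPartialHomeomorph M E4) (x : M) : E4 →L[ℝ] E4 :=
  mfderiv 𝓘(ℝ, E4) 𝓘(ℝ, E4) e x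

/-- The derivative of the inverse of a chart as an endomorphism of the model space. -/
def chartDerivSymm (e : OpenPartialHomeomorph M E4) (y : E4) : E4 →L[ℝ] E4 :=
  mfderiv 𝓘(ℝ, E4) 𝓘(ℝ, E4) e.symm y

/-- A differential form as a function with values in the forms on the model space. -/
def formFun {k : ℕ} (α : DForm M k) : M → E4 [⋀^Fin k]→L[ℝ] ℝ := α

/-- Restating the definition through `formFun` and `chartDerivSymm`, whose values live on the fixed
model space, allows base points such as `e.symm (e x)` to be rewritten without dependent types. -/
theorem formInChart_eq (e : OpenPartialHomeomorph M E4) {k : ℕ} (α : DForm M k) (y : E4) :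
    formInChart e α y = (formFun α (e.symm y)).compContinuousLinearMap (chartDerivSymm e y) := rfl

theorem formFun_extD {k : ℕ} (α : DForm M k) (x : M) :
    formFun (extD α) x = (extDeriv (formInChart (chartAt E4 x) α)
      (chartAt E4 x x)).compContinuousLinearMap (chartDeriv (chartAt E4 x) x) := rfl

variable [IsManifold 𝓘(ℝ, E4) ∞ M] {e c : OpenPartialHomeomorph M E4}

omit [IsManifold 𝓘(ℝ, E4) ∞ M] in
theorem chart_mDifferentiable (he : e ∈ IsManifold.maximalAtlas 𝓘(ℝ, E4) ∞ M) :
    e.MDifferentiable 𝓘(ℝ, E4) 𝓘(ℝ, E4) :=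
  ⟨(contMDiffOn_of_mem_maximalAtlas he).mdifferentiableOn (by simp),
    (contMDiffOn_symm_of_mem_maximalAtlas he).mdifferentiableOn (by simp)⟩

theorem chartAt_mem_maximalAtlas (x : M) :
    chartAt E4 x ∈ IsManifold.maximalAtlas 𝓘(ℝ, E4) ∞ M :=
  IsManifold.chart_mem_maximalAtlas x

omit [IsManifold 𝓘(ℝ, E4) ∞ M] in
theorem chartDerivSymm_chartDeriv (he : e ∈ IsManifold.maximalAtlas 𝓘(ℝ, E4) ∞ M) {x : M}
    (hx : x ∈ e.source) (v : E4) : chartDerivSymm e (e x) (chartDeriv e x v) = v :=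
  congrArg (fun l : E4 →L[ℝ] E4 => l v) ((chart_mDifferentiable he).symm_comp_deriv hx)

omit [IsManifold 𝓘(ℝ, E4) ∞ M] in
theorem chartDeriv_chartDerivSymm (he : e ∈ IsManifold.maximalAtlas 𝓘(ℝ, E4) ∞ M) {y : E4}
    (hy : y ∈ e.target) (v : E4) : chartDeriv e (e.symm y) (chartDerivSymm e y v) = v :=
  congrArg (fun l : E4 →L[ℝ] E4 => l v) ((chart_mDifferentiable he).comp_symm_deriv hy)

omit [IsManifold 𝓘(ℝ, E4) ∞ M] in
theorem contDiffAt_transition (he : e ∈ IsManifold.maximalAtlas 𝓘(ℝ, E4) ∞ M)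
    (hc : c ∈ IsManifold.maximalAtlas 𝓘(ℝ, E4) ∞ M) {y : E4} (hy : y ∈ e.target)
    (hyc : e.symm y ∈ c.source) : ContDiffAt ℝ ∞ (fun z => c (e.symm z)) y := by
  rw [← contMDiffAt_iff_contDiffAt]
  exact (contMDiffAt_of_mem_maximalAtlas hc hyc).comp y (contMDiffAt_symm_of_mem_maximalAtlas he hy)

omit [IsManifold 𝓘(ℝ, E4) ∞ M] in
theorem fderiv_transition (he : e ∈ IsManifold.maximalAtlas 𝓘(ℝ, E4) ∞ M)
    (hc : c ∈ IsManifold.maximalAtlas 𝓘(ℝ, E4) ∞ M) {y : E4} (hy : y ∈ e.target)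
    (hyc : e.symm y ∈ c.source) :
    fderiv ℝ (fun z => c (e.symm z)) y = (chartDeriv c (e.symm y)).comp (chartDerivSymm e y) := by
  have h := mfderiv_comp y ((chart_mDifferentiable hc).mdifferentiableAt hyc)
    ((chart_mDifferentiable he).mdifferentiableAt_symm hy)
  rw [mfderiv_eq_fderiv] at h
  exact h

omit [IsManifold 𝓘(ℝ, E4) ∞ M] in
theorem formInChart_transition (he : e ∈ IsManifold.maximalAtlas 𝓘(ℝ, E4) ∞ M)
    (hc : c ∈ IsManifold.maximalAtlas 𝓘(ℝ, E4) ∞ M) {k : ℕ} (α : DForm M k) {y : E4}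
    (hy : y ∈ e.target) (hyc : e.symm y ∈ c.source) :
    formInChart e α y = (formInChart c α (c (e.symm y))).compContinuousLinearMap
      (fderiv ℝ (fun z => c (e.symm z)) y) := by
  rw [fderiv_transition he hc hy hyc, formInChart_eq, formInChart_eq, c.left_inv hyc]
  ext v
  change formFun α (e.symm y) _ = formFun α (e.symm y) _
  congr 1
  funext i
  exact (chartDerivSymm_chartDeriv hc hyc _).symm

/-- The exterior derivative may be computed in any chart. -/
theorem formInChart_extD (he : e ∈ IsManifold.maximalAtlas 𝓘(ℝ, E4) ∞ M) {k : ℕ} {α : DForm M k}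
    {y : E4} (hy : y ∈ e.target) (hα : DifferentiableAt ℝ (formInChart e α) y) :
    formInChart e (extD α) y = extDeriv (formInChart e α) y := by
  set x := e.symm y with hx
  set c := chartAt E4 x with hcdef
  have hc : c ∈ IsManifold.maximalAtlas 𝓘(ℝ, E4) ∞ M := chartAt_mem_maximalAtlas x
  have hxc : x ∈ c.source := mem_chart_source E4 x
  have hxe : x ∈ e.source := e.map_target hy
  have hex : e x = y := e.right_inv hy
  have hcx : c.symm (c x) = x := c.left_inv hxc
  have hcy : c x ∈ c.target := c.map_source hxc
  have hf := contDiffAt_transition hc he hcy (by rwa [hcx])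
  have h1 : formInChart c α =ᶠ[nhds (c x)] fun z => (formInChart e α
      (e (c.symm z))).compContinuousLinearMap (fderiv ℝ (fun z => e (c.symm z)) z) := by
    have hn : c.target ∩ c.symm ⁻¹' e.source ∈ nhds (c x) :=
      (c.isOpen_inter_preimage_symm e.open_source).mem_nhds ⟨hcy, by
        change c.symm (c x) ∈ e.source
        rwa [hcx]⟩
    filter_upwards [hn] with z hz
    exact formInChart_transition hc he α hz.1 hz.2
  -- Near the point the two chart expressions differ by pullback along the transition map, and d
  -- commutes with pullback. The remaining derivatives of charts then cancel in pairs.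
  have h2 : extDeriv (formInChart c α) (c x) = (extDeriv (formInChart e α)
      y).compContinuousLinearMap (fderiv ℝ (fun z => e (c.symm z)) (c x)) := by
    have e1 : e (c.symm (c x)) = y := by rw [hcx, hex]
    rw [h1.extDeriv_eq, extDeriv_pullback (by rwa [e1]) hf (by simpa using two_le_smooth), e1]
  rw [formInChart_eq, formFun_extD, ← hx, ← hcdef, h2,
    fderiv_transition hc he hcy (by rwa [hcx]), hcx]
  ext v
  change extDeriv (formInChart e α) y _ = _
  congr 1
  funext i
  change chartDeriv e x (chartDerivSymm c (c x) (chartDeriv c x (chartDerivSymm e y (v i)))) = v i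
  rw [chartDerivSymm_chartDeriv hc hxc, hx, chartDeriv_chartDerivSymm he hy]

omit [IsManifold 𝓘(ℝ, E4) ∞ M] in
/-- Two forms that agree in a chart at a point agree at the point. -/
theorem form_eq_of_formInChart_eq (he : e ∈ IsManifold.maximalAtlas 𝓘(ℝ, E4) ∞ M) {x : M}
    (hx : x ∈ e.source) {k : ℕ} {α β : DForm M k}
    (h : formInChart e α (e x) = formInChart e β (e x)) : α x = β x := by
  have key : ∀ γ : DForm M k, formFun γ x =
      (formInChart e γ (e x)).compContinuousLinearMap (chartDeriv e x) := fun γ => by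
    rw [formInChart_eq, e.left_inv hx]
    ext v
    change formFun γ x _ = formFun γ x _
    congr 1
    funext i
    exact (chartDerivSymm_chartDeriv he hx _).symm
  exact (key α).trans ((congrArg (fun f => f.compContinuousLinearMap (chartDeriv e x)) h).trans
    (key β).symm)

/-! ### Vector fields in a chart -/

/-- The coordinate vector field `∂_i` of a chart. -/
def coordField (e : OpenPartialHomeomorph M E4) (i : Fin 4) : VField M :=
  VectorField.mpullback 𝓘(ℝ, E4) 𝓘(ℝ, E4) e (fun _ => stdVec i)

omit [IsManifold 𝓘(ℝ, E4) ∞ M] in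
theorem isInvertible_chartDeriv (he : e ∈ IsManifold.maximalAtlas 𝓘(ℝ, E4) ∞ M) {x : M}
    (hx : x ∈ e.source) : (mfderiv 𝓘(ℝ, E4) 𝓘(ℝ, E4) e x).IsInvertible :=
  ⟨(chart_mDifferentiable he).mfderiv hx, rfl⟩

omit [IsManifold 𝓘(ℝ, E4) ∞ M] in
theorem isInvertible_chartDerivSymm (he : e ∈ IsManifold.maximalAtlas 𝓘(ℝ, E4) ∞ M) {y : E4}
    (hy : y ∈ e.target) : (mfderiv 𝓘(ℝ, E4) 𝓘(ℝ, E4) e.symm y).IsInvertible :=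
  ⟨(chart_mDifferentiable he).symm.mfderiv hy, rfl⟩

omit [IsManifold 𝓘(ℝ, E4) ∞ M] in
-- `mpullback` applies `ContinuousLinearMap.inverse`, which is a true inverse only where the
-- derivative is invertible; on the domain of the chart it is the derivative of `e.symm`.
theorem coordField_eq (he : e ∈ IsManifold.maximalAtlas 𝓘(ℝ, E4) ∞ M) {x : M}
    (hx : x ∈ e.source) (i : Fin 4) : coordField e i x = chartDerivSymm e (e x) (stdVec i) := by
  have := chartDeriv_chartDerivSymm he (e.map_source hx) (stdVec i)
  rw [e.left_inv hx] at this
  exact (isInvertible_chartDeriv he hx).inverse_apply_eq.2 this.symm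

theorem contMDiffAt_coordField (he : e ∈ IsManifold.maximalAtlas 𝓘(ℝ, E4) ∞ M) {x : M}
    (hx : x ∈ e.source) (i : Fin 4) : ContMDiffAt 𝓘(ℝ, E4) 𝓘(ℝ, E4).tangent ∞
      (fun y => (⟨y, coordField e i y⟩ : TangentBundle 𝓘(ℝ, E4) M)) x := by
  have h0 : ContMDiffAt 𝓘(ℝ, E4) 𝓘(ℝ, E4).tangent ∞
      (fun y : E4 => (⟨y, stdVec i⟩ : TangentBundle 𝓘(ℝ, E4) E4)) (e x) :=
    contMDiffAt_vectorSpace_iff_contDiffAt.2 contDiffAt_const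
  exact h0.mpullback_vectorField_preimage (contMDiffAt_of_mem_maximalAtlas he hx)
    (isInvertible_chartDeriv he hx) (by simp)

/-- The components of a vector field in a chart. -/
def vecComp (e : OpenPartialHomeomorph M E4) (K : VField M) (i : Fin 4) (y : E4) : ℝ :=
  (show E4 from VectorField.mpullback 𝓘(ℝ, E4) 𝓘(ℝ, E4) e.symm K y) i

omit [IsManifold 𝓘(ℝ, E4) ∞ M] in
theorem mpullback_symm_eq (he : e ∈ IsManifold.maximalAtlas 𝓘(ℝ, E4) ∞ M) (K : VField M) {y : E4}
    (hy : y ∈ e.target) : VectorField.mpullback 𝓘(ℝ, E4) 𝓘(ℝ, E4) e.symm K y =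
      chartDeriv e (e.symm y) (K (e.symm y)) := by
  have := chartDerivSymm_chartDeriv he (e.map_target hy) (K (e.symm y))
  rw [e.right_inv hy] at this
  exact (isInvertible_chartDerivSymm he hy).inverse_apply_eq.2 this.symm

theorem contDiffAt_mpullback_symm (he : e ∈ IsManifold.maximalAtlas 𝓘(ℝ, E4) ∞ M) {K : VField M}
    {y : E4} (hy : y ∈ e.target) (hK : ContMDiffAt 𝓘(ℝ, E4) 𝓘(ℝ, E4).tangent ∞
      (fun x => (⟨x, K x⟩ : TangentBundle 𝓘(ℝ, E4) M)) (e.symm y)) :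
    ContDiffAt ℝ ∞ (fun z => (show E4 from
      VectorField.mpullback 𝓘(ℝ, E4) 𝓘(ℝ, E4) e.symm K z)) y :=
  contMDiffAt_vectorSpace_iff_contDiffAt.1 <| hK.mpullback_vectorField_preimage
    (contMDiffAt_symm_of_mem_maximalAtlas he hy) (isInvertible_chartDerivSymm he hy) (by simp)

theorem contDiffAt_vecComp (he : e ∈ IsManifold.maximalAtlas 𝓘(ℝ, E4) ∞ M) {K : VField M}
    {y : E4} (hy : y ∈ e.target) (hK : ContMDiffAt 𝓘(ℝ, E4) 𝓘(ℝ, E4).tangent ∞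
      (fun x => (⟨x, K x⟩ : TangentBundle 𝓘(ℝ, E4) M)) (e.symm y)) (i : Fin 4) :
    ContDiffAt ℝ ∞ (vecComp e K i) y :=
  (EuclideanSpace.proj i : E4 →L[ℝ] ℝ).contDiff.contDiffAt.comp y
    (contDiffAt_mpullback_symm he hy hK)

end Chart

/-! ### Metric, volume form and Hodge star in a chart -/

namespace Spacetime

open Bundle

variable {M : Type*} [TopologicalSpace M] [ChartedSpace E4 M] [IsManifold 𝓘(ℝ, E4) ∞ M]
  (S : Spacetime M) {e : OpenPartialHomeomorph M E4}

/-- The metric as a function with values in the bilinear forms on the model space. -/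
def metricFun (x : M) : E4 →L[ℝ] E4 →L[ℝ] ℝ := S.g x

/-- The metric in a chart. -/
def metricInChart (e : OpenPartialHomeomorph M E4) (y : E4) : E4 →L[ℝ] E4 →L[ℝ] ℝ :=
  (S.metricFun (e.symm y)).bilinearComp (chartDerivSymm e y) (chartDerivSymm e y)

theorem metricInChart_apply (e : OpenPartialHomeomorph M E4) (y v w : E4) :
    S.metricInChart e y v w =
      S.metricFun (e.symm y) (chartDerivSymm e y v) (chartDerivSymm e y w) := rfl

theorem contMDiffAt_metric_coordField (he : e ∈ IsManifold.maximalAtlas 𝓘(ℝ, E4) ∞ M) {x : M}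
    (hx : x ∈ e.source) (i j : Fin 4) : ContMDiffAt 𝓘(ℝ, E4) 𝓘(ℝ) ∞
      (fun y => S.g y (coordField e i y) (coordField e j y)) x := by
  have h : ContMDiffAt 𝓘(ℝ, E4) (𝓘(ℝ, E4).prod 𝓘(ℝ)) ∞
      (fun y => TotalSpace.mk' ℝ (E := Bundle.Trivial M ℝ) y
        (S.g y (coordField e i y) (coordField e j y))) x :=
    ContMDiffAt.clm_bundle_apply₂ (F₁ := E4) (F₂ := E4) (S.contMDiff_g x)
      (contMDiffAt_coordField he hx i) (contMDiffAt_coordField he hx j)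
  simp only [contMDiffAt_totalSpace] at h
  exact h.2

theorem gLow_eq (he : e ∈ IsManifold.maximalAtlas 𝓘(ℝ, E4) ∞ M) {x : M} (hx : x ∈ e.source)
    (i j : Fin 4) : S.gLow e (e x) i j = S.g x (coordField e i x) (coordField e j x) := by
  rw [coordField_eq he hx, coordField_eq he hx]
  change S.metricFun (e.symm (e x)) _ _ = S.metricFun x _ _
  rw [e.left_inv hx]
  rfl

theorem contDiffAt_gLow (he : e ∈ IsManifold.maximalAtlas 𝓘(ℝ, E4) ∞ M) {y : E4}
    (hy : y ∈ e.target) (i j : Fin 4) : ContDiffAt ℝ ∞ (fun z => S.gLow e z i j) y := by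
  have h1 := (S.contMDiffAt_metric_coordField he (e.map_target hy) i j).comp y
    (contMDiffAt_symm_of_mem_maximalAtlas he hy)
  refine (contMDiffAt_iff_contDiffAt.1 h1).congr_of_eventuallyEq ?_
  filter_upwards [e.open_target.mem_nhds hy] with z hz
  have := S.gLow_eq he (e.map_target hz) i j
  rw [e.right_inv hz] at this
  exact this

theorem exists_orthonormal (x : M) : ∃ b : Fin 4 → E4,
    (∀ i j, S.metricFun x (b i) (b j) = Matrix.diagonal ![(1 : ℝ), -1, -1, -1] i j) ∧
      (formFun S.τ x b = 1 ∨ formFun S.τ x b = -1) := by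
  obtain ⟨b, hb⟩ := S.signature x
  exact ⟨fun i => b i, hb, S.vol x b hb⟩

theorem det_gramMatrix_metricFun_ne_zero (x : M) : (gramMatrix (S.metricFun x)).det ≠ 0 := by
  obtain ⟨b, hb, hτ⟩ := S.exists_orthonormal x
  exact (volume_sq hb hτ).2.2

theorem volume_sq_in_chart (he : e ∈ IsManifold.maximalAtlas 𝓘(ℝ, E4) ∞ M) {y : E4}
    (hy : y ∈ e.target) : formInChart e S.τ y stdVec ^ 2 =
      -(gramMatrix (S.metricInChart e y)).det ∧ formInChart e S.τ y stdVec ≠ 0 ∧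
        (gramMatrix (S.metricInChart e y)).det ≠ 0 := by
  obtain ⟨b, hb, hτ⟩ := S.exists_orthonormal (e.symm y)
  have hinv : ∀ v, chartDerivSymm e y (chartDeriv e (e.symm y) v) = v := fun v => by
    have := chartDerivSymm_chartDeriv he (e.map_target hy) v
    rwa [e.right_inv hy] at this
  refine volume_sq (b := fun i => chartDeriv e (e.symm y) (b i)) (fun i j => ?_) ?_
  · rw [metricInChart_apply, hinv, hinv, hb]
  · have : formInChart e S.τ y (fun i => chartDeriv e (e.symm y) (b i)) =
        formFun S.τ (e.symm y) b := by
      rw [formInChart_eq]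
      change formFun S.τ (e.symm y) (fun i => chartDerivSymm e y _) = _
      simp only [hinv]
    rwa [this]

/-- Smoothness of τ is given in the preferred charts only. In any other chart its component is
multiplied by the Jacobian determinant of the transition map, which is smooth. -/
theorem contDiffAt_volume (he : e ∈ IsManifold.maximalAtlas 𝓘(ℝ, E4) ∞ M) {y : E4}
    (hy : y ∈ e.target) : ContDiffAt ℝ ∞ (fun z => formInChart e S.τ z stdVec) y := by
  set c := chartAt E4 (e.symm y) with hcdef
  have hc : c ∈ IsManifold.maximalAtlas 𝓘(ℝ, E4) ∞ M := chartAt_mem_maximalAtlas _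
  have hyc : e.symm y ∈ c.source := mem_chart_source E4 _
  have hf := contDiffAt_transition he hc hy hyc
  have h1 : ContDiffAt ℝ ∞ (fun z => formInChart c S.τ z stdVec) (c (e.symm y)) :=
    (ContinuousAlternatingMap.apply ℝ E4 ℝ stdVec).contDiff.contDiffAt.comp _
      ((S.contDiff_τ (e.symm y)).contDiffAt (c.open_target.mem_nhds (c.map_source hyc)))
  have h2 : ∀ i j, ContDiffAt ℝ ∞
      (fun z => (fderiv ℝ (fun z => c (e.symm z)) z (stdVec i)) j) y := fun i j =>
    (EuclideanSpace.proj j : E4 →L[ℝ] ℝ).contDiff.contDiffAt.comp y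
      ((hf.fderiv_right (m := ∞) (by simp)).clm_apply contDiffAt_const)
  have h3 : ContDiffAt ℝ ∞ (fun z => (Matrix.of fun i j =>
      (fderiv ℝ (fun z => c (e.symm z)) z (stdVec i)) j).det *
        formInChart c S.τ (c (e.symm z)) stdVec) y := by
    refine ContDiffAt.mul ?_ (ContDiffAt.comp
      (g := fun z => formInChart c S.τ z stdVec) (f := fun z => c (e.symm z)) y h1 hf)
    simp only [Matrix.det_apply]
    refine ContDiffAt.sum fun σ _ => ContDiffAt.const_smul _ ?_
    exact contDiffAt_prod fun i _ => h2 _ _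
  refine h3.congr_of_eventuallyEq ?_
  filter_upwards [(e.isOpen_inter_preimage_symm c.open_source).mem_nhds ⟨hy, hyc⟩] with z hz
  rw [formInChart_transition he hc S.τ hz.1 hz.2]
  have e2 : eps 0 1 2 3 = 1 := by decide
  have e3 := alternating_sum_smul_stdVec (formInChart c S.τ (c (e.symm z))) (Matrix.of fun i j =>
      (fderiv ℝ (fun z => c (e.symm z)) z (stdVec i)) j) id
  simp only [id, e2, Int.cast_one, one_mul, Matrix.of_apply, sum_stdVec] at e3
  exact e3

/-- The Hodge star in a chart. -/
theorem formInChart_star (he : e ∈ IsManifold.maximalAtlas 𝓘(ℝ, E4) ∞ M) {y : E4}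
    (hy : y ∈ e.target) {k m : ℕ} (h : m + k = 4) (A : DForm M k) :
    formInChart e (S.star h A) y =
      linHodgeStar (S.metricInChart e y) (formInChart e S.τ y) h (formInChart e A y) := by
  have hinv : ∀ v, chartDerivSymm e y (chartDeriv e (e.symm y) v) = v := fun v => by
    have := chartDerivSymm_chartDeriv he (e.map_target hy) v
    rwa [e.right_inv hy] at this
  exact (linHodgeStar_compContinuousLinearMap (S.det_gramMatrix_metricFun_ne_zero (e.symm y))
    (S.volume_sq_in_chart he hy).2.2 hinv (S.metricInChart_apply e y)
    (formFun S.τ (e.symm y)) h (formFun A (e.symm y))).symm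

end Spacetime

/-! ### The Killing equation in a chart -/

theorem fderiv_eq_sum_pderiv4 (f : E4 → ℝ) (y v : E4) :
    fderiv ℝ f y v = ∑ l, v l * pderiv4 l f y := by
  conv_lhs => rw [← sum_stdVec v]
  simp [pderiv4]

theorem bilinear_apply_stdVec_right (g : E4 →L[ℝ] E4 →L[ℝ] ℝ) (v : E4) (j : Fin 4) :
    g v (stdVec j) = ∑ l, v l * gramMatrix g l j := by
  conv_lhs => rw [← sum_stdVec v]
  simp [gramMatrix]

theorem bilinear_apply_stdVec_left (g : E4 →L[ℝ] E4 →L[ℝ] ℝ) (v : E4) (i : Fin 4) :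
    g (stdVec i) v = ∑ l, v l * gramMatrix g i l := by
  conv_lhs => rw [← sum_stdVec v]
  simp [gramMatrix]

/-- Constant multiples of Killing fields are Killing. -/
theorem KillingComponents.const_mul {U : Set E4} {G : E4 → Matrix (Fin 4) (Fin 4) ℝ} {t : E4 → ℝ}
    {k : Fin 4 → E4 → ℝ} (hK : KillingComponents U G t k) (c : ℝ) :
    KillingComponents U G t (fun i y => c * k i y) where
  isOpen := hK.isOpen
  smooth_G := hK.smooth_G
  symm := hK.symm
  smooth_t := hK.smooth_t
  t_ne := hK.t_ne
  t_sq := hK.t_sq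
  smooth_k y hy i := contDiffAt_const.mul (hK.smooth_k y hy i)
  killing y hy i j := by
    have h := congrArg (fun r => c * r) (hK.killing y hy i j)
    simp only [mul_zero, Finset.mul_sum] at h
    rw [← h]
    refine Finset.sum_congr rfl fun l _ => ?_
    rw [pderiv4_const_mul c (hK.dk hy l), pderiv4_const_mul c (hK.dk hy l)]
    ring

namespace Spacetime

open VectorField

theorem mlieBracket_eq_lieBracket (V W : Π y : E4, TangentSpace 𝓘(ℝ, E4) y) (y : E4) :
    mlieBracket 𝓘(ℝ, E4) V W y = lieBracket ℝ V W y := by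
  rw [← mlieBracketWithin_univ, mlieBracketWithin_eq_lieBracketWithin]
  exact congrFun lieBracketWithin_univ y

variable {M : Type*} [TopologicalSpace M] [ChartedSpace E4 M] [IsManifold 𝓘(ℝ, E4) ∞ M]
  (S : Spacetime M) {e : OpenPartialHomeomorph M E4}

theorem metricFun_eq (he : e ∈ IsManifold.maximalAtlas 𝓘(ℝ, E4) ∞ M) {y : E4}
    (hy : y ∈ e.target) (v w : E4) : S.metricFun (e.symm y) v w =
      S.metricInChart e y (chartDeriv e (e.symm y) v) (chartDeriv e (e.symm y) w) := by
  have hinv : ∀ v, chartDerivSymm e y (chartDeriv e (e.symm y) v) = v := fun v => by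
    have := chartDerivSymm_chartDeriv he (e.map_target hy) v
    rwa [e.right_inv hy] at this
  rw [metricInChart_apply, hinv, hinv]

omit [IsManifold 𝓘(ℝ, E4) ∞ M] in
theorem chartDeriv_coordField (he : e ∈ IsManifold.maximalAtlas 𝓘(ℝ, E4) ∞ M) {y : E4}
    (hy : y ∈ e.target) (i : Fin 4) :
    chartDeriv e (e.symm y) (coordField e i (e.symm y)) = stdVec i := by
  rw [coordField_eq he (e.map_target hy), e.right_inv hy]
  exact chartDeriv_chartDerivSymm he hy _

/-- The bracket is natural under pullback by `e.symm`, and in the chart ∂_i is a constant field, so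
[K, ∂_i] reduces to -∂_i K. -/
theorem chartDeriv_mlieBracket (he : e ∈ IsManifold.maximalAtlas 𝓘(ℝ, E4) ∞ M) {K : VField M}
    {y : E4} (hy : y ∈ e.target) (hK : ContMDiffAt 𝓘(ℝ, E4) 𝓘(ℝ, E4).tangent ∞
      (fun x => (⟨x, K x⟩ : TangentBundle 𝓘(ℝ, E4) M)) (e.symm y)) (i l : Fin 4) :
    (chartDeriv e (e.symm y) (mlieBracket 𝓘(ℝ, E4) K (coordField e i) (e.symm y))) l =
      -pderiv4 i (vecComp e K l) y := by
  have : IsManifold 𝓘(ℝ, E4) (minSmoothness ℝ 2) M := by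
    rw [minSmoothness_of_isRCLikeNormedField]
    exact IsManifold.of_le two_le_smooth
  let k : E4 → E4 := fun z => mpullback 𝓘(ℝ, E4) 𝓘(ℝ, E4) e.symm K z
  have h1 := mpullback_mlieBracket (n := ∞) (hK.mdifferentiableAt (by simp))
    ((contMDiffAt_coordField he (e.map_target hy) i).mdifferentiableAt (by simp))
    (contMDiffAt_symm_of_mem_maximalAtlas he hy) (by simpa using two_le_smooth)
  have h2 : mpullback 𝓘(ℝ, E4) 𝓘(ℝ, E4) e.symm (coordField e i) =ᶠ[nhds y]
      fun _ => stdVec i := by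
    filter_upwards [e.open_target.mem_nhds hy] with z hz
    exact (mpullback_symm_eq he _ hz).trans (chartDeriv_coordField he hz i)
  have h3 : mlieBracket 𝓘(ℝ, E4) (mpullback 𝓘(ℝ, E4) 𝓘(ℝ, E4) e.symm K)
      (mpullback 𝓘(ℝ, E4) 𝓘(ℝ, E4) e.symm (coordField e i)) y = -fderiv ℝ k y (stdVec i) := by
    refine (Filter.EventuallyEq.mlieBracket_vectorField_eq Filter.EventuallyEq.rfl h2).trans ?_
    have h4 : lieBracket ℝ k (fun _ => stdVec i) y = -fderiv ℝ k y (stdVec i) := by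
      simp [lieBracket]
    exact (mlieBracket_eq_lieBracket _ _ y).trans h4
  have h5 : chartDeriv e (e.symm y) (mlieBracket 𝓘(ℝ, E4) K (coordField e i) (e.symm y)) =
      -fderiv ℝ k y (stdVec i) :=
    ((mpullback_symm_eq he _ hy).symm.trans h1).trans h3
  rw [h5]
  have h6 : pderiv4 i (vecComp e K l) y = (fderiv ℝ k y (stdVec i)) l := by
    have hd : DifferentiableAt ℝ k y :=
      (contDiffAt_mpullback_symm he hy hK).differentiableAt (by simp)
    have := ((EuclideanSpace.proj l : E4 →L[ℝ] ℝ).hasFDerivAt.comp y hd.hasFDerivAt).fderiv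
    change fderiv ℝ ((EuclideanSpace.proj l : E4 →L[ℝ] ℝ) ∘ k) y (stdVec i) = _
    rw [this]
    rfl
  rw [h6]
  rfl

variable {S} in
/-- The Killing equation in a chart. -/
theorem IsKilling.killingComponents {K : VField M} (hK : S.IsKilling K)
    (he : e ∈ IsManifold.maximalAtlas 𝓘(ℝ, E4) ∞ M) :
    KillingComponents e.target (fun y => gramMatrix (S.metricInChart e y))
      (fun y => formInChart e S.τ y stdVec) (vecComp e K) where
  isOpen := e.open_target
  smooth_G y hy i j := S.contDiffAt_gLow he hy i j
  symm y _ i j := S.symm _ _ _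
  smooth_t y hy := S.contDiffAt_volume he hy
  t_ne y hy := (S.volume_sq_in_chart he hy).2.1
  t_sq y hy := (S.volume_sq_in_chart he hy).1
  smooth_k y hy i := contDiffAt_vecComp he hy (hK.contMDiff _) i
  killing y hy i j := by
    have hx := e.map_target hy
    have hX := fun i => (contMDiffAt_coordField he hx i).mdifferentiableAt (n := ∞) (by simp)
    -- The Killing condition asks for differentiability of the test fields at the point alone, so
    -- coordinate fields, meaningful only on the chart domain, are admissible.
    have h := hK.lie_eq_zero (e.symm y) (coordField e i) (coordField e j) (hX i) (hX j)
    have h1 : mvfderiv 𝓘(ℝ, E4) (fun z => S.g z (coordField e i z) (coordField e j z)) (e.symm y)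
        (K (e.symm y)) = ∑ l, vecComp e K l y *
          pderiv4 l (fun z => gramMatrix (S.metricInChart e z) i j) y := by
      have e1 : (fun z => gramMatrix (S.metricInChart e z) i j) =ᶠ[nhds y]
          (fun z => S.g z (coordField e i z) (coordField e j z)) ∘ e.symm := by
        filter_upwards [e.open_target.mem_nhds hy] with z hz
        have := S.gLow_eq he (e.map_target hz) i j
        rw [e.right_inv hz] at this
        exact this
      have e2 := mfderiv_comp y
        ((S.contMDiffAt_metric_coordField he hx i j).mdifferentiableAt (by simp))
        ((chart_mDifferentiable he).mdifferentiableAt_symm hy)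
      rw [mfderiv_eq_fderiv, ← e1.fderiv_eq] at e2
      have e3 := fderiv_eq_sum_pderiv4 (fun z => gramMatrix (S.metricInChart e z) i j) y
        (mpullback 𝓘(ℝ, E4) 𝓘(ℝ, E4) e.symm K y)
      refine Eq.trans ?_ e3
      have e4 : chartDerivSymm e y (mpullback 𝓘(ℝ, E4) 𝓘(ℝ, E4) e.symm K y) = K (e.symm y) := by
        refine (congrArg (chartDerivSymm e y) (mpullback_symm_eq he K hy)).trans ?_
        have := chartDerivSymm_chartDeriv he hx (K (e.symm y))
        rwa [e.right_inv hy] at this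
      have e5 := congrArg (fun l : E4 →L[ℝ] ℝ => l (mpullback 𝓘(ℝ, E4) 𝓘(ℝ, E4) e.symm K y)) e2
      refine Eq.trans ?_ e5.symm
      exact (congrArg (fun v : E4 => (mfderiv 𝓘(ℝ, E4) 𝓘(ℝ)
        (fun z => S.g z (coordField e i z) (coordField e j z)) (e.symm y) : E4 →L[ℝ] ℝ) v) e4).symm
    have h2 : S.g (e.symm y) (mlieBracket 𝓘(ℝ, E4) K (coordField e i) (e.symm y))
        (coordField e j (e.symm y)) = ∑ l, -pderiv4 i (vecComp e K l) y *
          gramMatrix (S.metricInChart e y) l j := by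
      refine (S.metricFun_eq he hy _ _).trans ?_
      rw [chartDeriv_coordField he hy, bilinear_apply_stdVec_right]
      exact Finset.sum_congr rfl fun l _ => by
        rw [chartDeriv_mlieBracket he hy (hK.contMDiff _)]
    have h3 : S.g (e.symm y) (coordField e i (e.symm y))
        (mlieBracket 𝓘(ℝ, E4) K (coordField e j) (e.symm y)) =
        ∑ l, -pderiv4 j (vecComp e K l) y * gramMatrix (S.metricInChart e y) i l := by
      refine (S.metricFun_eq he hy _ _).trans ?_
      rw [chartDeriv_coordField he hy, bilinear_apply_stdVec_left]
      exact Finset.sum_congr rfl fun l _ => by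
        rw [chartDeriv_mlieBracket he hy (hK.contMDiff _)]
    rw [h1, h2, h3, ← Finset.sum_sub_distrib, ← Finset.sum_sub_distrib] at h
    rw [← h]
    exact Finset.sum_congr rfl fun l _ => by ring

end Spacetime

/-! ### Current, Lorenz gauge and d² = 0 for the potential -/

theorem one_form_eq_sum (α : E4 [⋀^Fin 1]→L[ℝ] ℝ) :
    α = ∑ j, α (fun _ => stdVec j) • ContinuousAlternatingMap.ofSubsingleton ℝ E4 ℝ (0 : Fin 1)
      (EuclideanSpace.proj j : E4 →L[ℝ] ℝ) := by
  refine one_form_ext fun i => ?_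
  simp [ContinuousAlternatingMap.sum_apply]

/-- A 1-form is a combination of the constant forms dx^j with its components as coefficients, so
smooth components suffice. -/
theorem contDiffAt_one_form {A : E4 → E4 [⋀^Fin 1]→L[ℝ] ℝ} {y : E4}
    (h : ∀ j, ContDiffAt ℝ ∞ (fun z => A z (fun _ => stdVec j)) y) : ContDiffAt ℝ ∞ A y := by
  have e : A = fun z => ∑ j, A z (fun _ => stdVec j) •
      ContinuousAlternatingMap.ofSubsingleton ℝ E4 ℝ (0 : Fin 1)
        (EuclideanSpace.proj j : E4 →L[ℝ] ℝ) := funext fun z => one_form_eq_sum (A z)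
  rw [e]
  exact ContDiffAt.sum fun j _ => (h j).smul contDiffAt_const

theorem extDeriv_one_form_apply {A : E4 → E4 [⋀^Fin 1]→L[ℝ] ℝ} {y : E4}
    (hA : DifferentiableAt ℝ A y) (i j : Fin 4) : extDeriv A y ![stdVec i, stdVec j] =
      pderiv4 i (fun z => A z (fun _ => stdVec j)) y -
        pderiv4 j (fun z => A z (fun _ => stdVec i)) y := by
  rw [extDeriv_apply hA, Fin.sum_univ_two]
  have e0 : (0 : Fin 2).removeNth ![stdVec i, stdVec j] = fun _ => stdVec j := by
    funext a
    rw [Subsingleton.elim a 0]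
    rfl
  have e1 : (1 : Fin 2).removeNth ![stdVec i, stdVec j] = fun _ => stdVec i := by
    funext a
    rw [Subsingleton.elim a 0]
    rfl
  rw [e0, e1]
  simp [pderiv4, sub_eq_add_neg]

theorem linHodgeStar_zero (g : E4 →L[ℝ] E4 →L[ℝ] ℝ) (τ : E4 [⋀^Fin 4]→L[ℝ] ℝ) {k m : ℕ}
    (h : m + k = 4) : linHodgeStar g τ h (0 : E4 [⋀^Fin k]→L[ℝ] ℝ) = 0 := by
  simp [linHodgeStar]

theorem sum_smul_linear_apply (a : Fin 4 → ℝ) (l : Fin 4 → E4 →L[ℝ] ℝ) (v : E4) :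
    (∑ i, a i • l i) v = ∑ i, a i * l i v := by
  simp

theorem smul_sum_smul_form_apply {k : ℕ} (c : ℝ) (a : Fin 4 → ℝ)
    (α : Fin 4 → E4 [⋀^Fin k]→L[ℝ] ℝ) (v : Fin k → E4) :
    (c • ∑ i, a i • α i) v = c * ∑ i, a i * α i v := by
  simp [ContinuousAlternatingMap.sum_apply]

namespace Spacetime

variable {M : Type*} [TopologicalSpace M] [ChartedSpace E4 M] [IsManifold 𝓘(ℝ, E4) ∞ M]
  {S : Spacetime M} {e : OpenPartialHomeomorph M E4}

theorem codiff_apply {k m : ℕ} (h : m + (k + 1) = 4) (A : DForm M (k + 1)) (x : M) :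
    formFun (S.codiff h A) x = (-1 : ℝ) ^ (k + 1) • (-(-1 : ℝ) ^ (k * (m + 1))) •
      linHodgeStar (S.metricFun x) (formFun S.τ x) (by omega)
        (formFun (extD (S.star h A)) x) := rfl

omit [IsManifold 𝓘(ℝ, E4) ∞ M] in
theorem formInChart_neg (e : OpenPartialHomeomorph M E4) {k : ℕ} (α : DForm M k) (y : E4) :
    formInChart e (fun x => -α x) y = -formInChart e α y := rfl

theorem formInChart_codiff (e : OpenPartialHomeomorph M E4) {k m : ℕ} (h : m + (k + 1) = 4)
    (A : DForm M (k + 1)) (y : E4) :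
    formInChart e (S.codiff h A) y = (-1 : ℝ) ^ (k + 1) • (-(-1 : ℝ) ^ (k * (m + 1))) •
      formInChart e (S.star (k := m + 1) (by omega) (extD (S.star h A))) y := rfl

/-- The components of the `1`-form `A` in the chart `e` are `g_{jl} k^l`. -/
def HasLowComp (S : Spacetime M) (e : OpenPartialHomeomorph M E4) (A : DForm M 1)
    (k : Fin 4 → E4 → ℝ) : Prop :=
  ∀ z ∈ e.target, ∀ j, formInChart e A z (fun _ => stdVec j) =
    lowComp (fun y => gramMatrix (S.metricInChart e y)) k j z

/-- Carrying the constant c along lets the same lemma serve K itself (c = 1) and the potential. -/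
theorem hasLowComp_flat (he : e ∈ IsManifold.maximalAtlas 𝓘(ℝ, E4) ∞ M) (K : VField M) (c : ℝ) :
    HasLowComp S e (c • S.flat K) (fun i y => c * vecComp e K i y) := by
  intro z hz j
  have h1 : formInChart e (c • S.flat K) z (fun _ => stdVec j) =
      c * S.metricFun (e.symm z) (K (e.symm z)) (chartDerivSymm e z (stdVec j)) := rfl
  have h2 : S.metricFun (e.symm z) (K (e.symm z)) (chartDerivSymm e z (stdVec j)) =
      S.metricInChart e z (chartDeriv e (e.symm z) (K (e.symm z))) (stdVec j) :=
    (S.metricFun_eq he hz _ _).trans (congrArg (fun v => S.metricInChart e z _ v)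
      (chartDeriv_chartDerivSymm he hz _))
  have h3 : ∀ l, vecComp e K l z = (chartDeriv e (e.symm z) (K (e.symm z))) l := fun l =>
    congrArg (fun v : E4 => v l) (mpullback_symm_eq he K hz)
  have h4 : ∀ l, gramMatrix (S.metricInChart e z) l j = gramMatrix (S.metricInChart e z) j l :=
    fun l => S.symm _ _ _
  rw [h1, h2, bilinear_apply_stdVec_right, lowComp, Finset.mul_sum]
  refine Finset.sum_congr rfl fun l _ => ?_
  rw [h3, h4]
  ring

theorem formInChart_current_eq (e : OpenPartialHomeomorph M E4) (F : DForm M 2) (y : E4)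
    (v : Fin 1 → E4) : formInChart e (S.current F) y v =
      -(formInChart e (S.codiff (k := 1) (m := 2) rfl F) y v) := by
  rw [← codiff₂]
  generalize hB : S.codiff₂ F = B
  have h : S.current F = fun x => -B x := by rw [← hB]; unfold current; rfl
  rw [h, formInChart_neg]
  rfl

section Components

variable {k : Fin 4 → E4 → ℝ} (hK : KillingComponents e.target
  (fun y => gramMatrix (S.metricInChart e y)) (fun y => formInChart e S.τ y stdVec) k)
  (he : e ∈ IsManifold.maximalAtlas 𝓘(ℝ, E4) ∞ M) {A : DForm M 1} (hA : HasLowComp S e A k)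
  {y : E4} (hy : y ∈ e.target)

include hK hA hy

theorem contDiffAt_formInChart : ContDiffAt ℝ ∞ (formInChart e A) y := by
  refine contDiffAt_one_form fun j => (hK.smooth_lowComp hy j).congr_of_eventuallyEq ?_
  filter_upwards [e.open_target.mem_nhds hy] with z hz
  exact hA z hz j

include he

theorem formInChart_extD_oneForm : formInChart e (extD A) y = extDeriv (formInChart e A) y :=
  formInChart_extD he hy ((contDiffAt_formInChart hK hA hy).differentiableAt (by simp))

theorem formInChart_extD_apply (i j : Fin 4) : formInChart e (extD A) y ![stdVec i, stdVec j] =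
    curlComp (fun y => gramMatrix (S.metricInChart e y)) k i j y := by
  rw [formInChart_extD_oneForm hK he hA hy,
    extDeriv_one_form_apply ((contDiffAt_formInChart hK hA hy).differentiableAt (by simp)), curlComp]
  have h : ∀ j, (fun z => formInChart e A z (fun _ => stdVec j)) =ᶠ[nhds y]
      lowComp (fun y => gramMatrix (S.metricInChart e y)) k j := fun j => by
    filter_upwards [e.open_target.mem_nhds hy] with z hz
    exact hA z hz j
  rw [pderiv4_congr (h i), pderiv4_congr (h j)]

theorem formInChart_extD_extD : formInChart e (extD (extD A)) y = 0 := by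
  have h1 : formInChart e (extD A) =ᶠ[nhds y] extDeriv (formInChart e A) := by
    filter_upwards [e.open_target.mem_nhds hy] with z hz
    exact formInChart_extD_oneForm hK he hA hz
  have h2 := contDiffAt_formInChart hK hA hy
  have h3 : DifferentiableAt ℝ (extDeriv (formInChart e A)) y := by
    have h4 : DifferentiableAt ℝ (fderiv ℝ (formInChart e A)) y :=
      (h2.fderiv_right (m := ∞) (by simp)).differentiableAt (by simp)
    exact (ContinuousAlternatingMap.alternatizeUncurryFinCLM ℝ E4 ℝ).differentiableAt.comp y h4
  rw [formInChart_extD he hy (h1.differentiableAt_iff.2 h3), h1.extDeriv_eq]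
  exact extDeriv_extDeriv_apply h2 (by simpa using two_le_smooth)

theorem formInChart_extD_star_oneForm :
    formInChart e (extD (S.star (k := 1) (m := 3) rfl A)) y = 0 := by
  have h1 : formInChart e (S.star (k := 1) (m := 3) rfl A) =ᶠ[nhds y] fun z =>
      linHodgeStar (S.metricInChart e z) (formInChart e S.τ z) (m := 3) rfl (formInChart e A z) := by
    filter_upwards [e.open_target.mem_nhds hy] with z hz
    exact S.formInChart_star he hz rfl A
  rw [formInChart_extD he hy (h1.differentiableAt_iff.2 (hK.differentiableAt_star_oneForm hy hA)),
    h1.extDeriv_eq]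
  exact hK.extDeriv_star_oneForm hy hA

theorem formInChart_current (c : Fin 4) :
    formInChart e (S.current (extD A)) y (fun _ => stdVec c) =
      2 * ∑ l, k l y * S.ricci e l c y := by
  have h1 : formInChart e (S.star (k := 2) (m := 2) rfl (extD A)) =ᶠ[nhds y] fun z =>
      linHodgeStar (S.metricInChart e z) (formInChart e S.τ z) (m := 2) rfl
        (formInChart e (extD A) z) := by
    filter_upwards [e.open_target.mem_nhds hy] with z hz
    exact S.formInChart_star he hz rfl (extD A)
  have hF : ∀ z ∈ e.target, ∀ i j, formInChart e (extD A) z ![stdVec i, stdVec j] =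
      curlComp (fun y => gramMatrix (S.metricInChart e y)) k i j z := fun z hz i j =>
    formInChart_extD_apply hK he hA hz i j
  rw [formInChart_current_eq, formInChart_codiff, S.formInChart_star he hy, formInChart_extD he hy
    (h1.differentiableAt_iff.2 (hK.differentiableAt_star_twoForm hy hF)), h1.extDeriv_eq,
    ContinuousAlternatingMap.smul_apply, ContinuousAlternatingMap.smul_apply,
    hK.star_extDeriv_star_twoForm hy hF]
  -- `gLow` is by definition the Gram matrix of `metricInChart`, so both Ricci expressions unfold to
  -- the same term.
  have h3 : ∀ l, S.ricci e l c y = ricciComp (fun y => gramMatrix (S.metricInChart e y)) l c y :=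
    fun l => rfl
  simp only [h3]
  -- For p = 2 the signs in δ are (-1)² and, from ⋆⁻¹ on 3-forms, -(-1)^{1·3}; both are 1. So δF =
  -- ⋆d⋆F, and the minus in the current cancels the one from ⋆d⋆F.
  norm_num

end Components

theorem codiff₁_eq_zero {A : DForm M 1}
    (hA : ∀ e ∈ IsManifold.maximalAtlas 𝓘(ℝ, E4) ∞ M, ∃ k, KillingComponents e.target
      (fun y => gramMatrix (S.metricInChart e y)) (fun y => formInChart e S.τ y stdVec) k ∧
        HasLowComp S e A k) : S.codiff₁ A = 0 := by
  funext x
  have hc := chartAt_mem_maximalAtlas x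
  obtain ⟨k, hK, hk⟩ := hA _ hc
  have h0 : extD (S.star (k := 1) (m := 3) rfl A) x = 0 := by
    refine form_eq_of_formInChart_eq hc (mem_chart_source E4 x) (β := 0) ?_
    rw [formInChart_extD_star_oneForm hK hc hk (mem_chart_target E4 x)]
    rfl
  have h1 : formFun (extD (S.star (k := 1) (m := 3) rfl A)) x = 0 := h0
  have h2 : formFun (S.codiff₁ A) x = 0 := by
    rw [codiff₁, codiff_apply, h1, linHodgeStar_zero, smul_zero, smul_zero]
  exact h2

theorem extD_extD_eq_zero {A : DForm M 1}
    (hA : ∀ e ∈ IsManifold.maximalAtlas 𝓘(ℝ, E4) ∞ M, ∃ k, KillingComponents e.target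
      (fun y => gramMatrix (S.metricInChart e y)) (fun y => formInChart e S.τ y stdVec) k ∧
        HasLowComp S e A k) : extD (extD A) = 0 := by
  funext x
  have hc := chartAt_mem_maximalAtlas x
  obtain ⟨k, hK, hk⟩ := hA _ hc
  refine form_eq_of_formInChart_eq hc (mem_chart_source E4 x) (β := 0) ?_
  rw [formInChart_extD_extD hK hc hk (mem_chart_target E4 x)]
  rfl

omit [IsManifold 𝓘(ℝ, E4) ∞ M] in
theorem coordCovec_chartDerivSymm (he : e ∈ IsManifold.maximalAtlas 𝓘(ℝ, E4) ∞ M) {x : M}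
    (hx : x ∈ e.source) (ν c : Fin 4) :
    coordCovec e ν x (chartDerivSymm e (e x) (stdVec c)) = if ν = c then 1 else 0 := by
  have := chartDeriv_chartDerivSymm he (e.map_source hx) (stdVec c)
  rw [e.left_inv hx] at this
  have h := congrArg (fun v : E4 => v ν) this
  rw [stdVec_apply] at h
  exact h

/-- The coefficients `a` are left open because the two halves of the theorem obtain k^β differently:
as dx^β(K), and by raising the index of A. -/
theorem current_eq_of_coeff {k : Fin 4 → E4 → ℝ} (hK : KillingComponents e.target
    (fun y => gramMatrix (S.metricInChart e y)) (fun y => formInChart e S.τ y stdVec) k)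
    (he : e ∈ IsManifold.maximalAtlas 𝓘(ℝ, E4) ∞ M) {A : DForm M 1} (hA : HasLowComp S e A k)
    {x : M} (hx : x ∈ e.source) {a : Fin 4 → M → ℝ} (ha : ∀ β, a β x = k β (e x)) :
    S.current (extD A) x = (2 : ℝ) • ∑ β, a β x • S.ricciForm e β x := by
  let B : DForm M 1 := fun z => (2 : ℝ) • ∑ β, a β z • S.ricciForm e β z
  refine form_eq_of_formInChart_eq he hx (β := B) (one_form_ext fun c => ?_)
  rw [formInChart_current hK he hA (e.map_source hx)]
  have hB : formInChart e B (e x) = (formFun B x).compContinuousLinearMap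
      (chartDerivSymm e (e x)) := by
    rw [formInChart_eq, e.left_inv hx]
  rw [hB]
  have hR : ∀ β, S.ricciForm e β x (fun _ => chartDerivSymm e (e x) (stdVec c)) =
      S.ricci e β c (e x) := fun β => by
    have h1 : S.ricciForm e β x (fun _ => chartDerivSymm e (e x) (stdVec c)) =
        (∑ ν, S.ricci e β ν (e x) • coordCovec e ν x)
          (chartDerivSymm e (e x) (stdVec c)) := rfl
    refine h1.trans ((sum_smul_linear_apply _ _ _).trans ?_)
    refine (Finset.sum_congr rfl fun ν _ => congrArg (fun r => S.ricci e β ν (e x) * r)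
      (coordCovec_chartDerivSymm he hx ν c)).trans ?_
    simp
  have h2 : ((formFun B x).compContinuousLinearMap (chartDerivSymm e (e x))) (fun _ => stdVec c) =
      ((2 : ℝ) • ∑ β, a β x • S.ricciForm e β x)
        (fun _ => chartDerivSymm e (e x) (stdVec c)) := rfl
  refine Eq.trans ?_ (h2.trans (smul_sum_smul_form_apply _ _ _ _)).symm
  congr 1
  refine Finset.sum_congr rfl fun β _ => ?_
  rw [ha]
  exact congrArg (fun r => k β (e x) * r) (hR β).symm

theorem upComp_eq {k : Fin 4 → E4 → ℝ} (hK : KillingComponents e.target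
    (fun y => gramMatrix (S.metricInChart e y)) (fun y => formInChart e S.τ y stdVec) k)
    {A : DForm M 1} (hA : HasLowComp S e A k) {x : M} (hx : x ∈ e.source) (β : Fin 4) :
    S.upComp e A β x = k β (e x) := by
  rw [← hK.oneForm_recipVec (e.map_source hx) (hA _ (e.map_source hx)) β, recipVec,
    one_form_map_sum]
  rfl

end Spacetime

/-! ### The theorem on the manifold -/

theorem mainTheorem2 {M : Type*} [TopologicalSpace M] [T2Space M] [SecondCountableTopology M]
    [ChartedSpace E4 M] [IsManifold 𝓘(ℝ, E4) ∞ M] (S : Spacetime M)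
    (K : VField M) (hK : S.IsKilling K) :
    (∀ e ∈ IsManifold.maximalAtlas 𝓘(ℝ, E4) ∞ M, ∀ x ∈ e.source,
      S.current (extD (S.flat K)) x =
        (2 : ℝ) • ∑ β, Spacetime.coordCovec e β x (K x) • S.ricciForm e β x) ∧
    ∀ (c : ℝ) (A : DForm M 1), A = c • S.flat K →
      S.codiff₁ A = 0 ∧
      extD (extD A) = 0 ∧
      ∀ e ∈ IsManifold.maximalAtlas 𝓘(ℝ, E4) ∞ M, ∀ x ∈ e.source,
        S.current (extD A) x = (2 : ℝ) • ∑ β, S.upComp e A β x • S.ricciForm e β x := by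
  constructor
  · intro e he x hx
    -- Multiplying by 1 brings the components into the form `1 * k` that `hasLowComp_flat` supplies.
    have h1 := (hK.killingComponents he).const_mul 1
    have h2 := Spacetime.hasLowComp_flat (S := S) he K 1
    rw [one_smul] at h2
    refine Spacetime.current_eq_of_coeff h1 he h2 hx
      (a := fun β x => Spacetime.coordCovec e β x (K x)) fun β => ?_
    have h3 := congrArg (fun v : E4 => v β) (mpullback_symm_eq he K (e.map_source hx))
    rw [one_mul]
    refine Eq.trans ?_ h3.symm
    rw [e.left_inv hx]
    rfl
  · rintro c A rfl
    have h := fun e (he : e ∈ IsManifold.maximalAtlas 𝓘(ℝ, E4) ∞ M) =>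
      (⟨_, (hK.killingComponents he).const_mul c, Spacetime.hasLowComp_flat he K c⟩ :
        ∃ k, KillingComponents e.target (fun y => gramMatrix (S.metricInChart e y))
          (fun y => formInChart e S.τ y stdVec) k ∧ Spacetime.HasLowComp S e (c • S.flat K) k)
    refine ⟨Spacetime.codiff₁_eq_zero h, Spacetime.extD_extD_eq_zero h, fun e he x hx => ?_⟩
    obtain ⟨k, h1, h2⟩ := h e he
    exact Spacetime.current_eq_of_coeff h1 he h2 hx fun β => Spacetime.upComp_eq h1 h2 hx β

end
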